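/- Let $M$ be a smooth surface (a Hausdorff smooth $2$-manifold without boundary, orientable or not) and let $f\colon M\to\mathbb{R}^3$ be a minimal immersion, i.e. a smooth immersion with vanishing mean curvature, such that the induced metric on $M$ is complete. Let $r_c>0$, $r_m>0$, $\lambda>0$ with $\lambda\neq r_m$, and suppose that $r_m=r_c/(k+1)$ for some integer $k\ge 1$ (so $r_m=1/(k+1)$ when lengths are normalized so that $r_c=1$). Let $c=(x,y,0)$ be the single-wrapped epitrochoid $$x(t)=(r_c+r_m)\cos t-\lambda\cos\Bigl(\tfrac{r_c+r_m}{r_m}\,t\Bigr),\qquad y(t)=(r_c+r_m)\sin t-\lambda\sin\Bigl(\tfrac{r_c+r_m}{r_m}\,t\Bigr),\qquad t\in\mathbb{R}.$$ Then $f$ does not contain $c$, nor any image of $c$ under an isometry of $\mathbb{R}^3$, as a geodesic: there is no isometry $A$ of $\mathbb{R}^3$ and no smooth curve $\gamma\colon\mathbb{R}\to M$ with $f\circ\gamma=A\circ c$ which, up to reparametrization, is a geodesic of the induced metric. -/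

import Mathlib

open scoped Manifold ContDiff Topology ENNReal

noncomputable section

namespace MinimalEpitrochoid

/-- The Euclidean plane, on which surfaces are modelled. -/
abbrev E2 : Type := EuclideanSpace ℝ (Fin 2)

/-- Euclidean three-space. -/
abbrev E3 : Type := EuclideanSpace ℝ (Fin 3)

/-! ### Local surface theory in coordinates -/

/-- The partial derivative `∂F/∂uᵢ` of a map `F` of the coordinates `(u₀, u₁)`. -/
def partialDeriv (i : Fin 2) (F : E2 → E3) (u : E2) : E3 :=
  fderiv ℝ F u (EuclideanSpace.single i 1)

/-- The coefficients `⟪∂F/∂uᵢ, ∂F/∂uⱼ⟫` of the first fundamental form. -/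
def firstForm (F : E2 → E3) (u : E2) (i j : Fin 2) : ℝ :=
  inner ℝ (partialDeriv i F u) (partialDeriv j F u)

/-- The coefficients `⟪∂²F/∂uᵢ∂uⱼ, ν⟫` of the second fundamental form with respect to a unit
normal `ν` at the point `u`. -/
def secondForm (F : E2 → E3) (ν : E3) (u : E2) (i j : Fin 2) : ℝ :=
  inner ℝ (partialDeriv i (partialDeriv j F) u) ν

/-- The mean curvature `(E N - 2 F M + G L) / (2 (E G - F²))` at the point `u`, with respect to a
unit normal `ν` there. -/
def meanCurvature (F : E2 → E3) (ν : E3) (u : E2) : ℝ :=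
  (firstForm F u 0 0 * secondForm F ν u 1 1 - 2 * firstForm F u 0 1 * secondForm F ν u 0 1
      + firstForm F u 1 1 * secondForm F ν u 0 0)
    / (2 * (firstForm F u 0 0 * firstForm F u 1 1 - firstForm F u 0 1 ^ 2))

/-! ### Immersed surfaces -/

section Surface

variable {M : Type*} [TopologicalSpace M] [ChartedSpace E2 M]

/-- The differential of `f : M → ℝ³` at `p`, with values in `ℝ³`. -/
def differential (f : M → E3) (p : M) : TangentSpace (𝓡 2) p →L[ℝ] E3 :=
  mfderiv (𝓡 2) 𝓘(ℝ, E3) f p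

/-- `f` is a smooth immersion of the surface `M` in `ℝ³`. -/
structure IsSurfaceImmersion (f : M → E3) : Prop where
  smooth : ContMDiff (𝓡 2) 𝓘(ℝ, E3) ∞ f
  injective_differential : ∀ p : M, Function.Injective (differential f p)

/-- `f` is a minimal immersion: an immersion whose mean curvature vanishes identically, as computed
in every smooth chart `e` of `M` and with either choice of the unit normal `ν`. -/
structure IsMinimalImmersion (f : M → E3) : Prop extends IsSurfaceImmersion f where
  meanCurvature_eq_zero : ∀ e ∈ IsManifold.maximalAtlas (𝓡 2) ∞ M, ∀ u ∈ e.target, ∀ ν : E3,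
    ‖ν‖ = 1 → (∀ i, inner ℝ (partialDeriv i (f ∘ e.symm) u) ν = 0) →
      meanCurvature (f ∘ e.symm) ν u = 0

/-- The distance on `M` of the metric induced by `f`: the infimum of the lengths of `C¹` paths
joining two points, a tangent vector `v` having length `‖df v‖`. -/
def inducedEDist (f : M → E3) (p q : M) : ℝ≥0∞ :=
  letI : ∀ x : M, ENorm (TangentSpace (𝓡 2) x) := fun x => ⟨fun v => ‖differential f x v‖ₑ⟩
  Manifold.riemannianEDist (𝓡 2) p q

/-- The metric induced by `f` on `M` is complete: each of its Cauchy sequences converges in `M`. -/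
def IsCompleteSurface (f : M → E3) : Prop :=
  ∀ x : ℕ → M,
    (∀ ε : ℝ≥0∞, 0 < ε → ∃ N, ∀ m, N ≤ m → ∀ n, N ≤ n → inducedEDist f (x m) (x n) < ε) →
      ∃ p : M, Filter.Tendsto x Filter.atTop (𝓝 p)

/-- A smooth curve `γ` in `M`, regular and with an arbitrary parameter, is a geodesic of the metric
induced by `f`: its covariant acceleration, which is the tangential part of `(f ∘ γ)''`, is at each
time a multiple of its velocity. -/
structure IsGeodesicCurve (f : M → E3) (γ : ℝ → M) : Prop where
  smooth : ContMDiff 𝓘(ℝ, ℝ) (𝓡 2) ∞ γ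
  regular : ∀ t, deriv (f ∘ γ) t ≠ 0
  acceleration : ∀ t, ∃ a : ℝ, ∀ v : TangentSpace (𝓡 2) (γ t),
    inner ℝ (deriv (deriv (f ∘ γ)) t - a • deriv (f ∘ γ) t) (differential f (γ t) v) = 0

/-- The immersed surface `f` contains the parametrized space curve `c` as a geodesic. -/
def ContainsAsGeodesic (f : M → E3) (c : ℝ → E3) : Prop :=
  ∃ γ : ℝ → M, IsGeodesicCurve f γ ∧ ∀ t, f (γ t) = c t

end Surface

/-! ### Epitrochoids -/

/-- The epitrochoid in the `x₁x₂`-plane traced by a point at distance `lam` from the centre of a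
circle of radius `rm` that rolls around the outside of a fixed circle of radius `rc`. -/
def epitrochoid (rc rm lam t : ℝ) : E3 :=
  !₂[(rc + rm) * Real.cos t - lam * Real.cos ((rc + rm) / rm * t),
     (rc + rm) * Real.sin t - lam * Real.sin ((rc + rm) / rm * t),
     0]

/-- Single-wrapped: `rm = 1 / (k + 1)` with a positive integer `k`, in the unit of length in which
the fixed circle has radius `1`. -/
def IsSingleWrapped (rc rm : ℝ) : Prop :=
  ∃ k : ℕ, 0 < k ∧ rm = rc * (1 / ((k : ℝ) + 1))

end MinimalEpitrochoid

end

noncomputable section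

namespace MinimalEpitrochoid

/-! ### The conjugate differential of a minimal surface in coordinates -/

theorem conjugate_form_closed_algebra {V : Type*} [NormedAddCommGroup V] [InnerProductSpace ℝ V]
    (a b a0 a1 b1 : V) (E F G E1 F0 F1 G0 P P0 P1 : ℝ)
    (hE : E = inner ℝ a a) (hF : F = inner ℝ a b) (hG : G = inner ℝ b b)
    (hE1 : E1 = 2 * inner ℝ a a1) (hF0 : F0 = inner ℝ a a1 + inner ℝ a0 b)
    (hF1 : F1 = inner ℝ a b1 + inner ℝ a1 b) (hG0 : G0 = 2 * inner ℝ b a1)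
    (hP : P ^ 2 * (E * G - F ^ 2) = 1)
    (hP0 : P0 = -(1 / 2) * P ^ 3 * (2 * inner ℝ a a0 * G + E * G0 - 2 * F * F0))
    (hP1 : P1 = -(1 / 2) * P ^ 3 * (E1 * G + E * (2 * inner ℝ b b1) - 2 * F * F1))
    (X : V) (hX : X = P1 • (E • b - F • a) + P • (E1 • b + E • b1 - (F1 • a + F • a1))
      - (P0 • (F • b - G • a) + P • (F0 • b + F • a1 - (G0 • a + G • a0)))) :
    inner ℝ a X = 0 ∧ inner ℝ b X = 0 ∧ ∀ ν : V, inner ℝ a ν = 0 → inner ℝ b ν = 0 →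
      inner ℝ X ν = P * (E * inner ℝ b1 ν - 2 * F * inner ℝ a1 ν + G * inner ℝ a0 ν) := by
  have hba : inner ℝ b a = F := by rw [hF, real_inner_comm]
  have e1 : inner ℝ a0 b = F0 - inner ℝ a a1 := by rw [hF0]; ring
  have e2 : inner ℝ a1 b = G0 / 2 := by rw [hG0, real_inner_comm]; ring
  have e2' : inner ℝ b a1 = G0 / 2 := by rw [hG0]; ring
  have e3 : inner ℝ a a1 = E1 / 2 := by rw [hE1]; ring
  have e4 : inner ℝ a b1 = F1 - G0 / 2 := by rw [hF1, e2]; ring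
  have e5 : inner ℝ b a0 = F0 - E1 / 2 := by rw [real_inner_comm, e1, e3]
  have h3 : P ^ 3 * (E * G - F ^ 2) = P := by linear_combination P * hP
  refine ⟨?_, ?_, ?_⟩
  · subst hX
    simp only [inner_add_right, inner_sub_right, inner_smul_right, ← hE, ← hF, e3, e4]
    rw [hP0]
    linear_combination (-(1 / 2) * (2 * inner ℝ a a0 * G + E * G0 - 2 * F * F0)) * h3
  · subst hX
    simp only [inner_add_right, inner_sub_right, inner_smul_right, ← hG, hba, e2', e5]
    rw [hP1]
    linear_combination (-(1 / 2) * (E1 * G + E * (2 * inner ℝ b b1) - 2 * F * F1)) * h3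
  · intro ν ha hb
    subst hX
    simp only [inner_add_left, inner_sub_left, inner_smul_left, ha, hb]
    simp only [conj_trivial]
    ring

/-- `D⁻¹ᐟ²`, where `D` is the determinant of the first fundamental form. -/
def invArea (F : E2 → E3) (u : E2) : ℝ :=
  (Real.sqrt (firstForm F u 0 0 * firstForm F u 1 1 - firstForm F u 0 1 ^ 2))⁻¹

/-- The conjugate differential evaluated on the first coordinate vector. -/
def conjPartial0 (F : E2 → E3) (u : E2) : E3 :=
  invArea F u • (firstForm F u 0 0 • partialDeriv 1 F u - firstForm F u 0 1 • partialDeriv 0 F u)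

/-- The conjugate differential evaluated on the second coordinate vector. -/
def conjPartial1 (F : E2 → E3) (u : E2) : E3 :=
  invArea F u • (firstForm F u 0 1 • partialDeriv 1 F u - firstForm F u 1 1 • partialDeriv 0 F u)

theorem e2_eq (v : E2) :
    v = v 0 • EuclideanSpace.single 0 (1 : ℝ) + v 1 • EuclideanSpace.single 1 (1 : ℝ) := by
  ext i; fin_cases i <;> simp

theorem fderiv_eq_partialDeriv (F : E2 → E3) (u v : E2) :
    fderiv ℝ F u v = v 0 • partialDeriv 0 F u + v 1 • partialDeriv 1 F u := by
  conv_lhs => rw [e2_eq v]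
  simp [partialDeriv]

theorem firstForm_det_pos {F : E2 → E3} {u : E2} (h : Function.Injective (fderiv ℝ F u)) :
    0 < firstForm F u 0 0 * firstForm F u 1 1 - firstForm F u 0 1 ^ 2 := by
  have key : ∀ x y : ℝ, x • partialDeriv 0 F u + y • partialDeriv 1 F u = 0 → x = 0 ∧ y = 0 := by
    intro x y hxy
    have h0 : fderiv ℝ F u (!₂[x, y]) = fderiv ℝ F u 0 := by
      rw [fderiv_eq_partialDeriv]; simpa using hxy
    have := h h0
    exact ⟨by simpa using congrArg (fun v : E2 => v 0) this,
      by simpa using congrArg (fun v : E2 => v 1) this⟩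
  have h1 : 0 < firstForm F u 1 1 := by
    unfold firstForm
    rw [real_inner_self_eq_norm_sq]
    have : partialDeriv 1 F u ≠ 0 := fun h0 => by simpa using (key 0 1 (by simp [h0])).2
    positivity
  set w := firstForm F u 1 1 • partialDeriv 0 F u + (-firstForm F u 0 1) • partialDeriv 1 F u with hw
  have hw0 : w ≠ 0 := fun h0 => h1.ne' (key _ _ h0).1
  have hpos : 0 < inner ℝ w w := by rw [real_inner_self_eq_norm_sq]; positivity
  have hval : inner ℝ w w = firstForm F u 1 1 *
      (firstForm F u 0 0 * firstForm F u 1 1 - firstForm F u 0 1 ^ 2) := by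
    have hs : inner ℝ (partialDeriv 1 F u) (partialDeriv 0 F u) = firstForm F u 0 1 := by
      rw [real_inner_comm]; rfl
    have h01 : inner ℝ (partialDeriv 0 F u) (partialDeriv 1 F u) = firstForm F u 0 1 := rfl
    have h00 : inner ℝ (partialDeriv 0 F u) (partialDeriv 0 F u) = firstForm F u 0 0 := rfl
    have h11 : inner ℝ (partialDeriv 1 F u) (partialDeriv 1 F u) = firstForm F u 1 1 := rfl
    rw [hw]
    simp only [inner_add_left, inner_add_right, real_inner_smul_left, real_inner_smul_right,
      hs, h01, h00, h11]
    ring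
  rw [hval] at hpos
  exact (mul_pos_iff_of_pos_left h1).1 hpos

theorem invArea_sq_mul {F : E2 → E3} {u : E2} (h : Function.Injective (fderiv ℝ F u)) :
    invArea F u ^ 2 * (firstForm F u 0 0 * firstForm F u 1 1 - firstForm F u 0 1 ^ 2) = 1 := by
  have hD := firstForm_det_pos h
  rw [invArea, inv_pow, Real.sq_sqrt hD.le, inv_mul_cancel₀ hD.ne']

theorem contDiffOn_partialDeriv {F : E2 → E3} {U : Set E2} (hU : IsOpen U)
    (hF : ContDiffOn ℝ ∞ F U) (i : Fin 2) : ContDiffOn ℝ ∞ (partialDeriv i F) U := by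
  have := (hF.fderiv_of_isOpen hU (m := ∞) (by simp)).clm_apply
    (contDiffOn_const (c := EuclideanSpace.single i (1 : ℝ)))
  exact this

theorem contDiffOn_firstForm {F : E2 → E3} {U : Set E2} (hU : IsOpen U)
    (hF : ContDiffOn ℝ ∞ F U) (i j : Fin 2) : ContDiffOn ℝ ∞ (fun u => firstForm F u i j) U :=
  (contDiffOn_partialDeriv hU hF i).inner ℝ (contDiffOn_partialDeriv hU hF j)

theorem partialDeriv_comm {F : E2 → E3} {U : Set E2} (hU : IsOpen U)
    (hF : ContDiffOn ℝ ∞ F U) {u : E2} (hu : u ∈ U) :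
    partialDeriv 0 (partialDeriv 1 F) u = partialDeriv 1 (partialDeriv 0 F) u := by
  have hc : ContDiffAt ℝ ∞ F u := hF.contDiffAt (hU.mem_nhds hu)
  have hd : DifferentiableAt ℝ (fderiv ℝ F) u :=
    ((hF.fderiv_of_isOpen hU (m := ∞) (by simp)).contDiffAt (hU.mem_nhds hu)).differentiableAt
      (by simp)
  have hs := hc.isSymmSndFDerivAt (by simpa using WithTop.coe_le_coe.2 (le_top : (2 : ℕ∞) ≤ ⊤))
  have key : ∀ i j : Fin 2, partialDeriv i (partialDeriv j F) u =
      fderiv ℝ (fderiv ℝ F) u (EuclideanSpace.single i 1) (EuclideanSpace.single j 1) := by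
    intro i j
    have := (hd.hasFDerivAt.clm_apply
      (hasFDerivAt_const (EuclideanSpace.single j (1 : ℝ)) u)).fderiv
    unfold partialDeriv
    rw [this]
    simp
  rw [key, key]
  exact hs _ _

theorem hasFDerivAt_firstForm {F : E2 → E3} {u : E2}
    (dp : ∀ i, DifferentiableAt ℝ (partialDeriv i F) u) (i j : Fin 2) :
    ∃ L : E2 →L[ℝ] ℝ, HasFDerivAt (fun u => firstForm F u i j) L u ∧
      ∀ k, L (EuclideanSpace.single k 1) =
        inner ℝ (partialDeriv i F u) (partialDeriv k (partialDeriv j F) u) +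
          inner ℝ (partialDeriv k (partialDeriv i F) u) (partialDeriv j F u) :=
  ⟨_, (dp i).hasFDerivAt.inner ℝ (dp j).hasFDerivAt, fun k => by simp [partialDeriv]⟩

theorem hasDerivAt_inv_sqrt {x : ℝ} (hx : 0 < x) :
    HasDerivAt (fun y => (Real.sqrt y)⁻¹) (-(1 / 2) * (Real.sqrt x)⁻¹ ^ 3) x := by
  have h := (Real.hasDerivAt_sqrt hx.ne').fun_inv (Real.sqrt_pos.2 hx).ne'
  refine h.congr_deriv ?_
  have := (Real.sqrt_pos.2 hx).ne'
  field_simp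

theorem conjPartial_closed {F : E2 → E3} {U : Set E2} (hU : IsOpen U)
    (hF : ContDiffOn ℝ ∞ F U) (himm : ∀ u ∈ U, Function.Injective (fderiv ℝ F u))
    (hH : ∀ u ∈ U, ∀ ν : E3, ‖ν‖ = 1 → (∀ i, inner ℝ (partialDeriv i F u) ν = 0) →
      meanCurvature F ν u = 0) {u : E2} (hu : u ∈ U) :
    partialDeriv 1 (conjPartial0 F) u = partialDeriv 0 (conjPartial1 F) u := by
  have hn := hU.mem_nhds hu
  have hD := firstForm_det_pos (himm u hu)
  have hP := invArea_sq_mul (himm u hu)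
  have dp : ∀ i, DifferentiableAt ℝ (partialDeriv i F) u := fun i =>
    ((contDiffOn_partialDeriv hU hF i).contDiffAt hn).differentiableAt (by simp)
  have hcomm := partialDeriv_comm hU hF hu
  have hfd : ∀ i k, fderiv ℝ (partialDeriv i F) u (EuclideanSpace.single k 1) =
      partialDeriv k (partialDeriv i F) u := fun _ _ => rfl
  obtain ⟨LE, dE, hLE⟩ := hasFDerivAt_firstForm dp 0 0
  obtain ⟨LF, dF, hLF⟩ := hasFDerivAt_firstForm dp 0 1
  obtain ⟨LG, dG, hLG⟩ := hasFDerivAt_firstForm dp 1 1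
  have dP' := HasDerivAt.comp_hasFDerivAt u (hasDerivAt_inv_sqrt hD)
    ((dE.fun_mul dG).fun_sub (dF.pow 2))
  have dP : HasFDerivAt (invArea F) _ u := dP'
  have d0 : HasFDerivAt (conjPartial0 F) _ u :=
    dP.fun_smul ((dE.fun_smul (dp 1).hasFDerivAt).fun_sub (dF.fun_smul (dp 0).hasFDerivAt))
  have d1 : HasFDerivAt (conjPartial1 F) _ u :=
    dP.fun_smul ((dF.fun_smul (dp 1).hasFDerivAt).fun_sub (dG.fun_smul (dp 0).hasFDerivAt))
  obtain ⟨h1, h2, h3⟩ := conjugate_form_closed_algebra (partialDeriv 0 F u) (partialDeriv 1 F u)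
    (partialDeriv 0 (partialDeriv 0 F) u) (partialDeriv 1 (partialDeriv 0 F) u)
    (partialDeriv 1 (partialDeriv 1 F) u) (firstForm F u 0 0) (firstForm F u 0 1)
    (firstForm F u 1 1) (LE (EuclideanSpace.single 1 1)) (LF (EuclideanSpace.single 0 1))
    (LF (EuclideanSpace.single 1 1)) (LG (EuclideanSpace.single 0 1)) (invArea F u) _ _ rfl rfl rfl
    (by rw [hLE, real_inner_comm (partialDeriv 0 F u)]; ring) (by rw [hLF, hcomm])
    (by rw [hLF])
    (by rw [hLG, hcomm, real_inner_comm (partialDeriv 1 F u)]; ring) hP rfl rfl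
    (partialDeriv 1 (conjPartial0 F) u - partialDeriv 0 (conjPartial1 F) u) (by
      have r0 : partialDeriv 1 (conjPartial0 F) u = _ :=
        congrArg (fun L : E2 →L[ℝ] E3 => L (EuclideanSpace.single 1 1)) d0.fderiv
      have r1 : partialDeriv 0 (conjPartial1 F) u = _ :=
        congrArg (fun L : E2 →L[ℝ] E3 => L (EuclideanSpace.single 0 1)) d1.fderiv
      rw [r0, r1]
      simp only [add_apply, sub_apply, smul_apply, ContinuousLinearMap.smulRight_apply, hLE, hLF, hLG, hfd, hcomm]
      rw [real_inner_comm (partialDeriv 0 F u) (partialDeriv 0 (partialDeriv 0 F) u),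
        real_inner_comm (partialDeriv 1 F u) (partialDeriv 1 (partialDeriv 1 F) u)]
      simp only [invArea, smul_eq_mul, nsmul_eq_mul]
      module)
  by_contra hne
  set X := partialDeriv 1 (conjPartial0 F) u - partialDeriv 0 (conjPartial1 F) u with hX
  have hX0 : X ≠ 0 := sub_ne_zero.2 hne
  have hXn : ‖X‖ ≠ 0 := norm_ne_zero_iff.2 hX0
  have i0 : inner ℝ (partialDeriv 0 F u) (‖X‖⁻¹ • X) = 0 := by rw [inner_smul_right, h1, mul_zero]
  have i1 : inner ℝ (partialDeriv 1 F u) (‖X‖⁻¹ • X) = 0 := by rw [inner_smul_right, h2, mul_zero]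
  have hm := hH u hu (‖X‖⁻¹ • X) (by rw [norm_smul]; simp [hXn]) (by
    intro i; fin_cases i; exacts [i0, i1])
  have h4 := h3 _ i0 i1
  unfold meanCurvature secondForm at hm
  rw [div_eq_zero_iff, or_iff_left (by positivity), hcomm] at hm
  have h5 : inner ℝ X (‖X‖⁻¹ • X) = 0 := by
    rw [h4]; linear_combination (invArea F u) * hm
  rw [inner_smul_right, real_inner_self_eq_norm_sq] at h5
  have : ‖X‖⁻¹ * ‖X‖ ^ 2 ≠ 0 := by positivity
  exact this h5


/-! ### Conformal coordinates -/

/-- The real linear functional `h ↦ Re (g h)`. -/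
def reMul (g : ℂ) : ℂ →L[ℝ] ℝ := Complex.reCLM.comp (ContinuousLinearMap.mul ℝ ℂ g)

@[simp] theorem reMul_apply (g h : ℂ) : reMul g h = (g * h).re := rfl

theorem contDiffOn_invArea {F : E2 → E3} {U : Set E2} (hU : IsOpen U)
    (hF : ContDiffOn ℝ ∞ F U) (himm : ∀ u ∈ U, Function.Injective (fderiv ℝ F u)) :
    ContDiffOn ℝ ∞ (invArea F) U := by
  have hD : ContDiffOn ℝ ∞
      (fun u => firstForm F u 0 0 * firstForm F u 1 1 - firstForm F u 0 1 ^ 2) U :=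
    ((contDiffOn_firstForm hU hF 0 0).mul (contDiffOn_firstForm hU hF 1 1)).sub
      ((contDiffOn_firstForm hU hF 0 1).pow 2)
  exact (hD.sqrt fun u hu => (firstForm_det_pos (himm u hu)).ne').inv
    fun u hu => (Real.sqrt_pos.2 (firstForm_det_pos (himm u hu))).ne'

theorem contDiffOn_conjPartial0 {F : E2 → E3} {U : Set E2} (hU : IsOpen U)
    (hF : ContDiffOn ℝ ∞ F U) (himm : ∀ u ∈ U, Function.Injective (fderiv ℝ F u)) :
    ContDiffOn ℝ ∞ (conjPartial0 F) U :=
  (contDiffOn_invArea hU hF himm).smul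
    (((contDiffOn_firstForm hU hF 0 0).smul (contDiffOn_partialDeriv hU hF 1)).sub
      ((contDiffOn_firstForm hU hF 0 1).smul (contDiffOn_partialDeriv hU hF 0)))

theorem contDiffOn_conjPartial1 {F : E2 → E3} {U : Set E2} (hU : IsOpen U)
    (hF : ContDiffOn ℝ ∞ F U) (himm : ∀ u ∈ U, Function.Injective (fderiv ℝ F u)) :
    ContDiffOn ℝ ∞ (conjPartial1 F) U :=
  (contDiffOn_invArea hU hF himm).smul
    (((contDiffOn_firstForm hU hF 0 1).smul (contDiffOn_partialDeriv hU hF 1)).sub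
      ((contDiffOn_firstForm hU hF 1 1).smul (contDiffOn_partialDeriv hU hF 0)))

/-- The one-form on the plane with values in `ℝ³` and components `α`, `β`. -/
def planeForm (α β : E3) : E2 →L[ℝ] E3 :=
  (EuclideanSpace.proj 0 : E2 →L[ℝ] ℝ).smulRight α + (EuclideanSpace.proj 1 : E2 →L[ℝ] ℝ).smulRight β

@[simp] theorem planeForm_apply (α β : E3) (v : E2) : planeForm α β v = v 0 • α + v 1 • β := rfl

/-- A minimal immersion of a convex plane domain has a conjugate surface. -/
theorem exists_conjugate {F : E2 → E3} {U : Set E2} (hU : IsOpen U) (hconv : Convex ℝ U)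
    (hF : ContDiffOn ℝ ∞ F U) (himm : ∀ u ∈ U, Function.Injective (fderiv ℝ F u))
    (hH : ∀ u ∈ U, ∀ ν : E3, ‖ν‖ = 1 → (∀ i, inner ℝ (partialDeriv i F u) ν = 0) →
      meanCurvature F ν u = 0) :
    ∃ S : E2 → E3, ∀ u ∈ U, HasFDerivAt S (planeForm (conjPartial0 F u) (conjPartial1 F u)) u := by
  have d0 : ∀ u ∈ U, DifferentiableAt ℝ (conjPartial0 F) u := fun u hu =>
    ((contDiffOn_conjPartial0 hU hF himm).contDiffAt (hU.mem_nhds hu)).differentiableAt (by simp)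
  have d1 : ∀ u ∈ U, DifferentiableAt ℝ (conjPartial1 F) u := fun u hu =>
    ((contDiffOn_conjPartial1 hU hF himm).contDiffAt (hU.mem_nhds hu)).differentiableAt (by simp)
  have hd : ∀ u ∈ U, HasFDerivAt (fun u => planeForm (conjPartial0 F u) (conjPartial1 F u))
      ((ContinuousLinearMap.smulRightL ℝ E2 E3 (EuclideanSpace.proj 0)).comp
        (fderiv ℝ (conjPartial0 F) u) +
      (ContinuousLinearMap.smulRightL ℝ E2 E3 (EuclideanSpace.proj 1)).comp
        (fderiv ℝ (conjPartial1 F) u)) u := fun u hu =>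
    ((ContinuousLinearMap.smulRightL ℝ E2 E3 (EuclideanSpace.proj 0)).hasFDerivAt.comp u
      (d0 u hu).hasFDerivAt).add
    ((ContinuousLinearMap.smulRightL ℝ E2 E3 (EuclideanSpace.proj 1)).hasFDerivAt.comp u
      (d1 u hu).hasFDerivAt)
  refine hconv.exists_forall_hasFDerivAt_of_fderiv_symmetric hU
    (fun u hu => (hd u hu).differentiableAt.differentiableWithinAt) fun u hu x y => ?_
  rw [(hd u hu).fderiv]
  have hc := conjPartial_closed hU hF himm hH hu
  change y 0 • fderiv ℝ (conjPartial0 F) u x + y 1 • fderiv ℝ (conjPartial1 F) u x =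
    x 0 • fderiv ℝ (conjPartial0 F) u y + x 1 • fderiv ℝ (conjPartial1 F) u y
  simp only [fderiv_eq_partialDeriv, hc]
  module

/-- The linear map `v ↦ v₀ + τ v₁`. -/
def tauMap (τ : ℂ) : E2 →L[ℝ] ℂ :=
  (EuclideanSpace.proj 0 : E2 →L[ℝ] ℝ).smulRight 1 + (EuclideanSpace.proj 1 : E2 →L[ℝ] ℝ).smulRight τ

@[simp] theorem tauMap_apply (τ : ℂ) (v : E2) : tauMap τ v = v 0 + v 1 * τ := by
  simp [tauMap]

theorem exists_equiv_smul_tauMap {c τ : ℂ} (hc : c ≠ 0) (hτ : τ.im ≠ 0) :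
    ∃ A : E2 ≃L[ℝ] ℂ, (A : E2 →L[ℝ] ℂ) = c • tauMap τ := by
  have hinj : Function.Injective (c • tauMap τ : E2 →L[ℝ] ℂ).toLinearMap := by
    rw [← LinearMap.ker_eq_bot, LinearMap.ker_eq_bot']
    intro v hv
    have h : (v 0 : ℂ) + v 1 * τ = 0 := by
      simpa [hc] using hv
    have him := congrArg Complex.im h
    simp [hτ] at him
    have hre := congrArg Complex.re h
    simp [him] at hre
    ext i; fin_cases i <;> simp [him, hre]
  refine ⟨(LinearEquiv.ofInjectiveOfFinrankEq _ hinj (by simp)).toContinuousLinearEquiv, ?_⟩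
  ext v
  rfl

/-- The complex partial derivative `∂F/∂u₀ + i ∂S/∂u₀`, where `S` is the conjugate surface. -/
def complexPartial (F : E2 → E3) (k : Fin 3) (u : E2) : ℂ :=
  ⟨partialDeriv 0 F u k, conjPartial0 F u k⟩

/-- The ratio of the two complex partial derivatives. -/
def tau (F : E2 → E3) (u : E2) : ℂ :=
  ⟨firstForm F u 0 1 / firstForm F u 0 0, -((invArea F u)⁻¹ / firstForm F u 0 0)⟩

theorem firstForm_zero_pos {F : E2 → E3} {u : E2} (h : Function.Injective (fderiv ℝ F u)) :
    0 < firstForm F u 0 0 := by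
  have hD := firstForm_det_pos h
  have h0 : 0 ≤ firstForm F u 0 0 := real_inner_self_nonneg
  rcases h0.eq_or_lt with h0 | h0
  · rw [← h0] at hD
    nlinarith [sq_nonneg (firstForm F u 0 1)]
  · exact h0

theorem invArea_pos {F : E2 → E3} {u : E2} (h : Function.Injective (fderiv ℝ F u)) :
    0 < invArea F u := inv_pos.2 (Real.sqrt_pos.2 (firstForm_det_pos h))

theorem tau_im_ne_zero {F : E2 → E3} {u : E2} (h : Function.Injective (fderiv ℝ F u)) :
    (tau F u).im ≠ 0 := by
  have := firstForm_zero_pos h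
  have := invArea_pos h
  simp only [tau]
  exact neg_ne_zero.2 (by positivity)

theorem complexPartial_mul_tau {F : E2 → E3} {u : E2} (h : Function.Injective (fderiv ℝ F u))
    (k : Fin 3) :
    tau F u * complexPartial F k u = ⟨partialDeriv 1 F u k, conjPartial1 F u k⟩ := by
  have hE := firstForm_zero_pos h
  have hP := invArea_pos h
  have h1 := invArea_sq_mul h
  apply Complex.ext
  · simp only [Complex.mul_re, tau, complexPartial, conjPartial0, PiLp.smul_apply, PiLp.sub_apply,
      smul_eq_mul]
    field_simp
    ring
  · simp only [Complex.mul_im, tau, complexPartial, conjPartial0, conjPartial1, PiLp.smul_apply,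
      PiLp.sub_apply, smul_eq_mul]
    field_simp
    linear_combination (partialDeriv 0 F u k) * h1

theorem inner_e3 (x y : E3) : inner ℝ x y = x 0 * y 0 + x 1 * y 1 + x 2 * y 2 := by
  simp [PiLp.inner_apply, Fin.sum_univ_three, mul_comm]

theorem sum_complexPartial_sq {F : E2 → E3} {u : E2} (h : Function.Injective (fderiv ℝ F u)) :
    ∑ k, complexPartial F k u ^ 2 = 0 := by
  have h1 := invArea_sq_mul h
  have ha : inner ℝ (partialDeriv 0 F u) (conjPartial0 F u) = 0 := by
    simp only [conjPartial0, inner_smul_right, inner_sub_right]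
    change _ * (_ * firstForm F u 0 1 - _ * firstForm F u 0 0) = _
    ring
  have hn : inner ℝ (conjPartial0 F u) (conjPartial0 F u) = firstForm F u 0 0 := by
    simp only [conjPartial0, real_inner_smul_right, real_inner_smul_left, inner_sub_right,
      inner_sub_left]
    rw [real_inner_comm (partialDeriv 0 F u) (partialDeriv 1 F u)]
    change _ * (_ * (_ * (_ * firstForm F u 1 1 - _ * firstForm F u 0 1)) -
      _ * (_ * (_ * firstForm F u 0 1 - _ * firstForm F u 0 0))) = _
    linear_combination firstForm F u 0 0 * h1
  have hE : inner ℝ (partialDeriv 0 F u) (partialDeriv 0 F u) = firstForm F u 0 0 := rfl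
  rw [inner_e3] at ha hn hE
  apply Complex.ext
  · simp [Fin.sum_univ_three, complexPartial, pow_two]
    linarith
  · simp [Fin.sum_univ_three, complexPartial, pow_two]
    linarith

theorem exists_complexPartial_ne_zero {F : E2 → E3} {u : E2}
    (h : Function.Injective (fderiv ℝ F u)) : ∃ j, complexPartial F j u ≠ 0 := by
  by_contra! hc
  have : partialDeriv 0 F u = 0 := by
    ext k
    exact congrArg Complex.re (hc k)
  have hE := firstForm_zero_pos h
  simp [firstForm, this] at hE

/-- Near each point of a minimal surface in coordinates there is a complex coordinate in which the
surface is the real part of a holomorphic null curve with derivative `G`, and which is itself a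
component of that curve. -/
theorem exists_conformal_coordinate {F : E2 → E3} {U : Set E2} (hU : IsOpen U) (hconv : Convex ℝ U)
    (hF : ContDiffOn ℝ ∞ F U) (himm : ∀ u ∈ U, Function.Injective (fderiv ℝ F u))
    (hH : ∀ u ∈ U, ∀ ν : E3, ‖ν‖ = 1 → (∀ i, inner ℝ (partialDeriv i F u) ν = 0) →
      meanCurvature F ν u = 0) {u₀ : E2} (hu₀ : u₀ ∈ U) :
    ∃ (h : OpenPartialHomeomorph E2 ℂ) (G : Fin 3 → ℂ → ℂ) (j : Fin 3),
      u₀ ∈ h.source ∧ h.source ⊆ U ∧ ContDiffOn ℝ 1 h h.source ∧ ContDiffOn ℝ 1 h.symm h.target ∧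
      (∀ k, DifferentiableOn ℂ (G k) h.target) ∧ (∀ w ∈ h.target, ∑ k, G k w ^ 2 = 0) ∧
      (∀ w ∈ h.target, G j w = 1) ∧
      ∀ w ∈ h.target, ∀ k, HasFDerivAt (fun z => F (h.symm z) k) (reMul (G k w)) w := by
  obtain ⟨S, hS⟩ := exists_conjugate hU hconv hF himm hH
  obtain ⟨j, hj⟩ := exists_complexPartial_ne_zero (himm u₀ hu₀)
  set Φ : Fin 3 → E2 → ℂ := fun k u => (F u k : ℂ) + S u k * Complex.I with hΦdef
  have dF : ∀ u ∈ U, HasFDerivAt F (fderiv ℝ F u) u := fun u hu =>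
    ((hF.contDiffAt (hU.mem_nhds hu)).differentiableAt (by simp)).hasFDerivAt
  have dΦ : ∀ u ∈ U, ∀ k, HasFDerivAt (Φ k) (complexPartial F k u • tauMap (tau F u)) u := by
    intro u hu k
    have h1 := (EuclideanSpace.proj k : E3 →L[ℝ] ℝ).hasFDerivAt.comp u (dF u hu)
    have h2 := (EuclideanSpace.proj k : E3 →L[ℝ] ℝ).hasFDerivAt.comp u (hS u hu)
    have h3 := (Complex.ofRealCLM.hasFDerivAt.comp u h1).add
      ((Complex.ofRealCLM.hasFDerivAt.comp u h2).mul_const Complex.I)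
    refine h3.congr_fderiv ?_
    ext v
    have := complexPartial_mul_tau (himm u hu) k
    have hre := congrArg Complex.re this
    have him := congrArg Complex.im this
    simp only [Complex.mul_re, Complex.mul_im] at hre him
    apply Complex.ext
    · simp [fderiv_eq_partialDeriv]
      simp [complexPartial] at hre ⊢
      linear_combination (-v 1) * hre
    · simp
      simp [complexPartial] at him ⊢
      linear_combination (-v 1) * him
  have cS : ContDiffOn ℝ 1 S U := by
    rw [show (1 : WithTop ℕ∞) = 0 + 1 by simp, contDiffOn_succ_iff_fderiv_of_isOpen hU]
    refine ⟨fun u hu => (hS u hu).differentiableAt.differentiableWithinAt, by simp, ?_⟩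
    rw [contDiffOn_zero]
    refine ContinuousOn.congr (f := fun u => planeForm (conjPartial0 F u) (conjPartial1 F u)) ?_
      fun u hu => (hS u hu).fderiv
    exact ((ContinuousLinearMap.smulRightL ℝ E2 E3 (EuclideanSpace.proj 0)).continuous.comp_continuousOn
      (contDiffOn_conjPartial0 hU hF himm).continuousOn).add
      ((ContinuousLinearMap.smulRightL ℝ E2 E3 (EuclideanSpace.proj 1)).continuous.comp_continuousOn
      (contDiffOn_conjPartial1 hU hF himm).continuousOn)
  have cΦ : ContDiffOn ℝ 1 (Φ j) U := by
    have h1 : ContDiffOn ℝ 1 (fun u => F u j) U :=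
      (EuclideanSpace.proj j : E3 →L[ℝ] ℝ).contDiff.comp_contDiffOn (hF.of_le (by simp))
    have h2 : ContDiffOn ℝ 1 (fun u => S u j) U :=
      (EuclideanSpace.proj j : E3 →L[ℝ] ℝ).contDiff.comp_contDiffOn cS
    exact (Complex.ofRealCLM.contDiff.comp_contDiffOn h1).add
      ((Complex.ofRealCLM.contDiff.comp_contDiffOn h2).mul contDiffOn_const)
  have cc : ContinuousOn (complexPartial F j) U := by
    have h1 : ContinuousOn (fun u => partialDeriv 0 F u j) U :=
      (EuclideanSpace.proj j : E3 →L[ℝ] ℝ).continuous.comp_continuousOn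
        (contDiffOn_partialDeriv hU hF 0).continuousOn
    have h2 : ContinuousOn (fun u => conjPartial0 F u j) U :=
      (EuclideanSpace.proj j : E3 →L[ℝ] ℝ).continuous.comp_continuousOn
        (contDiffOn_conjPartial0 hU hF himm).continuousOn
    exact Complex.equivRealProdCLM.symm.continuous.comp_continuousOn (h1.prodMk h2)
  set V : Set E2 := U ∩ complexPartial F j ⁻¹' {0}ᶜ with hV
  have hVo : IsOpen V := cc.isOpen_inter_preimage hU isOpen_compl_singleton
  obtain ⟨A₀, hA₀⟩ := exists_equiv_smul_tauMap hj (tau_im_ne_zero (himm u₀ hu₀))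
  have hat := cΦ.contDiffAt (hU.mem_nhds hu₀)
  have hA₀' : HasFDerivAt (Φ j) (A₀ : E2 →L[ℝ] ℂ) u₀ := hA₀ ▸ dΦ u₀ hu₀ j
  set h := (hat.toOpenPartialHomeomorph _ hA₀' (by simp)).restrOpen V hVo with hh
  have hcoe : ∀ u, h u = Φ j u := fun u => rfl
  have hsrc : h.source ⊆ V := fun u hu => hu.2
  have hsymm : ∀ w ∈ h.target, h.symm w ∈ V := fun w hw => hsrc (h.map_target hw)
  have key : ∀ w ∈ h.target, ∃ A : E2 ≃L[ℝ] ℂ,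
      (A : E2 →L[ℝ] ℂ) = complexPartial F j (h.symm w) • tauMap (tau F (h.symm w)) ∧
      HasFDerivAt h (A : E2 →L[ℝ] ℂ) (h.symm w) := by
    intro w hw
    have hv := hsymm w hw
    obtain ⟨A, hA⟩ := exists_equiv_smul_tauMap hv.2 (tau_im_ne_zero (himm _ hv.1))
    exact ⟨A, hA, hA ▸ dΦ _ hv.1 j⟩
  have dG : ∀ k, ∀ w ∈ h.target, HasDerivAt (fun z => Φ k (h.symm z))
      (complexPartial F k (h.symm w) / complexPartial F j (h.symm w)) w := by
    intro k w hw
    have hv := hsymm w hw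
    obtain ⟨A, hA, hd⟩ := key w hw
    have hd2 := (dΦ _ hv.1 k).comp w (h.hasFDerivAt_symm hw hd)
    rw [hasDerivAt_iff_hasFDerivAt]
    refine hasFDerivAt_of_restrictScalars ℝ hd2 ?_
    ext1 z
    have h1 : A (A.symm z) = z := A.apply_symm_apply z
    have h2 : A (A.symm z) = (complexPartial F j (h.symm w) • tauMap (tau F (h.symm w))) (A.symm z) :=
      congrArg (fun L : E2 →L[ℝ] ℂ => L (A.symm z)) hA
    rw [h1] at h2
    have hne : complexPartial F j (h.symm w) ≠ 0 := hv.2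
    simp only [ContinuousLinearMap.coe_restrictScalars', ContinuousLinearMap.toSpanSingleton_apply,
      ContinuousLinearMap.comp_apply, smul_apply, smul_eq_mul,
      ContinuousLinearEquiv.coe_coe] at h2 ⊢
    rw [show z * (complexPartial F k (h.symm w) / complexPartial F j (h.symm w)) =
      complexPartial F k (h.symm w) / complexPartial F j (h.symm w) * z by ring]
    conv_lhs => rw [h2]
    field_simp
  refine ⟨h, fun k w => complexPartial F k (h.symm w) / complexPartial F j (h.symm w), j,
    ⟨hat.mem_toOpenPartialHomeomorph_source hA₀' (by simp), hu₀, hj⟩, fun u hu => (hsrc hu).1,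
    cΦ.mono fun u hu => (hsrc hu).1, ?_, ?_, ?_, ?_, ?_⟩
  · intro w hw
    obtain ⟨A, hA, hd⟩ := key w hw
    exact (h.contDiffAt_symm hw hd
      (cΦ.contDiffAt (hU.mem_nhds (hsymm w hw).1))).contDiffWithinAt
  · intro k
    have h1 : DifferentiableOn ℂ (fun z => Φ k (h.symm z)) h.target := fun w hw =>
      (dG k w hw).differentiableAt.differentiableWithinAt
    exact (h1.deriv h.open_target).congr fun w hw => (dG k w hw).deriv.symm
  · intro w hw
    have hv := hsymm w hw
    simp only [div_pow, ← Finset.sum_div, sum_complexPartial_sq (himm _ hv.1), zero_div]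
  · intro w hw
    exact div_self (hsymm w hw).2
  · intro w hw k
    have h1 := (dG k w hw).hasFDerivAt.restrictScalars ℝ
    have h2 := Complex.reCLM.hasFDerivAt.comp w h1
    refine (h2.congr_fderiv ?_).congr_of_eventuallyEq (Filter.Eventually.of_forall fun z => ?_)
    · ext z
      simp [mul_comm]
    · simp [hΦdef]


/-! ### Conformal charts of a minimal surface -/

section Chart

variable {M : Type*} [TopologicalSpace M] [ChartedSpace E2 M]

/-- A complex chart `ζ` in which `f` is locally the real part of a holomorphic null curve with
derivative `G`. -/
structure IsConformalChart (f : M → E3) (ζ : OpenPartialHomeomorph M ℂ) (G : Fin 3 → ℂ → ℂ) :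
    Prop where
  contMDiffOn : ContMDiffOn (𝓡 2) 𝓘(ℝ, ℂ) 1 ζ ζ.source
  contMDiffOn_symm : ContMDiffOn 𝓘(ℝ, ℂ) (𝓡 2) 1 ζ.symm ζ.target
  differentiableOn : ∀ k, DifferentiableOn ℂ (G k) ζ.target
  null : ∀ w ∈ ζ.target, ∑ k, G k w ^ 2 = 0
  hasFDerivAt : ∀ w ∈ ζ.target, ∀ k,
    HasFDerivAt (fun z => f (ζ.symm z) k) (reMul (G k w)) w

theorem IsSurfaceImmersion.contDiffOn_comp_symm [IsManifold (𝓡 2) ∞ M] {f : M → E3}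
    (hf : IsSurfaceImmersion f) (p : M) :
    ContDiffOn ℝ ∞ (f ∘ (chartAt E2 p).symm) (chartAt E2 p).target := by
  rw [← contMDiffOn_iff_contDiffOn]
  exact hf.smooth.comp_contMDiffOn (contMDiffOn_chart_symm (I := 𝓡 2))

theorem IsSurfaceImmersion.injective_fderiv_comp_symm [IsManifold (𝓡 2) ∞ M] {f : M → E3}
    (hf : IsSurfaceImmersion f) (p : M) {u : E2} (hu : u ∈ (chartAt E2 p).target) :
    Function.Injective (fderiv ℝ (f ∘ (chartAt E2 p).symm) u) := by
  set e := chartAt E2 p with he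
  have hsymm : MDifferentiableAt (𝓡 2) (𝓡 2) e.symm u :=
    ((contMDiffOn_chart_symm (I := 𝓡 2) (n := ∞) (x := p)).contMDiffAt
      (e.open_target.mem_nhds hu)).mdifferentiableAt (by simp)
  have hchart : MDifferentiableAt (𝓡 2) (𝓡 2) e (e.symm u) :=
    ((contMDiffOn_chart (I := 𝓡 2) (n := ∞) (x := p)).contMDiffAt
      (e.open_source.mem_nhds (e.map_target hu))).mdifferentiableAt (by simp)
  have hid : (mfderiv (𝓡 2) (𝓡 2) e (e.symm u)).comp (mfderiv (𝓡 2) (𝓡 2) e.symm u) =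
      ContinuousLinearMap.id ℝ (TangentSpace (𝓡 2) u) := by
    rw [← mfderiv_comp u hchart hsymm, ← mfderiv_id]
    apply Filter.EventuallyEq.mfderiv_eq
    filter_upwards [e.open_target.mem_nhds hu] with v hv using e.right_inv hv
  have hcomp : fderiv ℝ (f ∘ e.symm) u =
      (differential f (e.symm u)).comp (mfderiv (𝓡 2) (𝓡 2) e.symm u) := by
    rw [← mfderiv_eq_fderiv]
    exact mfderiv_comp u (hf.smooth.mdifferentiableAt (by simp)) hsymm
  intro x y hxy
  rw [hcomp] at hxy
  have h1 := hf.injective_differential _ hxy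
  have h2 := congrArg (mfderiv (𝓡 2) (𝓡 2) e (e.symm u)) h1
  have h3 : ∀ z : E2, mfderiv (𝓡 2) (𝓡 2) e (e.symm u) (mfderiv (𝓡 2) (𝓡 2) e.symm u z) = z :=
    fun z => congrArg (fun L => L z) hid
  exact (h3 x).symm.trans (h2.trans (h3 y))

theorem IsSurfaceImmersion.isLocallyInjective [IsManifold (𝓡 2) ∞ M] {f : M → E3}
    (hf : IsSurfaceImmersion f) : IsLocallyInjective f := by
  intro p
  set e := chartAt E2 p with he
  have hp : e p ∈ e.target := e.map_source (mem_chart_source E2 p)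
  have hinj := hf.injective_fderiv_comp_symm p hp
  obtain ⟨P, hP⟩ := (fderiv ℝ (f ∘ e.symm) (e p)).toLinearMap.exists_leftInverse_of_injective
    (LinearMap.ker_eq_bot.2 hinj)
  have hstrict := ((hf.contDiffOn_comp_symm p).contDiffAt
    (e.open_target.mem_nhds hp)).hasStrictFDerivAt (by simp)
  have hcomp := (LinearMap.toContinuousLinearMap P).hasStrictFDerivAt.comp (e p) hstrict
  have hid : (LinearMap.toContinuousLinearMap P).comp (fderiv ℝ (f ∘ e.symm) (e p)) =
      ((ContinuousLinearEquiv.refl ℝ E2 : E2 ≃L[ℝ] E2) : E2 →L[ℝ] E2) := by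
    ext1 v
    exact congrArg (fun L => L v) hP
  rw [← he, hid] at hcomp
  set h := hcomp.toOpenPartialHomeomorph _ with hh
  refine ⟨(e.trans h).source, (e.trans h).open_source, ?_, ?_⟩
  · rw [OpenPartialHomeomorph.trans_source]
    exact ⟨mem_chart_source E2 p, hcomp.mem_toOpenPartialHomeomorph_source⟩
  · intro x hx y hy hxy
    refine (e.trans h).injOn hx hy ?_
    rw [OpenPartialHomeomorph.trans_source] at hx hy
    change P (f (e.symm (e x))) = P (f (e.symm (e y)))
    rw [e.left_inv hx.1, e.left_inv hy.1, hxy]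

/-- A minimal surface has a conformal chart around each point, in which the coordinate is itself a
component of the null curve. -/
theorem IsMinimalImmersion.exists_isConformalChart [IsManifold (𝓡 2) ∞ M] {f : M → E3}
    (hf : IsMinimalImmersion f) (p : M) :
    ∃ (ζ : OpenPartialHomeomorph M ℂ) (G : Fin 3 → ℂ → ℂ) (j : Fin 3),
      IsConformalChart f ζ G ∧ p ∈ ζ.source ∧ ∀ w ∈ ζ.target, G j w = 1 := by
  set e := chartAt E2 p with he
  have hp : e p ∈ e.target := e.map_source (mem_chart_source E2 p)
  obtain ⟨r, hr, hball⟩ := Metric.isOpen_iff.1 e.open_target _ hp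
  obtain ⟨h, G, j, hsrc, hsub, hc, hcs, hG, hnull, hj, hd⟩ :=
    exists_conformal_coordinate (F := f ∘ e.symm) Metric.isOpen_ball (convex_ball (e p) r)
      ((hf.contDiffOn_comp_symm p).mono hball)
      (fun u hu => hf.injective_fderiv_comp_symm p (hball hu))
      (fun u hu ν h1 h2 => hf.meanCurvature_eq_zero e
        (IsManifold.chart_mem_maximalAtlas p) u (hball hu) ν h1 h2)
      (Metric.mem_ball_self hr)
  have ht : (e.trans h).target = h.target := by
    rw [OpenPartialHomeomorph.trans_target]
    exact Set.inter_eq_left.2 fun w hw => hball (hsub (h.map_target hw))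
  refine ⟨e.trans h, G, j, ⟨?_, ?_, ?_, ?_, ?_⟩, ?_, ?_⟩
  · have h1 : ContMDiffOn (𝓡 2) 𝓘(ℝ, ℂ) 1 h h.source := contMDiffOn_iff_contDiffOn.2 hc
    exact h1.comp' (contMDiffOn_chart (I := 𝓡 2) (x := p))
  · rw [ht]
    have h1 : ContMDiffOn 𝓘(ℝ, ℂ) (𝓡 2) 1 h.symm h.target := contMDiffOn_iff_contDiffOn.2 hcs
    exact (contMDiffOn_chart_symm (I := 𝓡 2) (x := p)).comp h1
      fun w hw => hball (hsub (h.map_target hw))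
  · rwa [ht]
  · rwa [ht]
  · rw [ht]
    exact hd
  · rw [OpenPartialHomeomorph.trans_source]
    exact ⟨mem_chart_source E2 p, hsrc⟩
  · rwa [ht]

/-- The conjugate of a conformal chart. -/
theorem IsConformalChart.conj {f : M → E3} {ζ : OpenPartialHomeomorph M ℂ} {G : Fin 3 → ℂ → ℂ}
    (h : IsConformalChart f ζ G) :
    IsConformalChart f (ζ.transHomeomorph Complex.conjCLE.toHomeomorph)
      (fun k w => starRingEnd ℂ (G k (starRingEnd ℂ w))) := by
  have hcd : ContMDiff 𝓘(ℝ, ℂ) 𝓘(ℝ, ℂ) 1 (fun z : ℂ => starRingEnd ℂ z) :=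
    (Complex.conjCLE.contDiff (n := 1)).contMDiff
  have ht : ∀ w, w ∈ (ζ.transHomeomorph Complex.conjCLE.toHomeomorph).target →
      starRingEnd ℂ w ∈ ζ.target := fun w hw => hw
  refine ⟨hcd.comp_contMDiffOn h.contMDiffOn, h.contMDiffOn_symm.comp hcd.contMDiffOn ht,
    fun k w hw => ?_, fun w hw => ?_, fun w hw k => ?_⟩
  · have h1 := ((h.differentiableOn k).differentiableAt (ζ.open_target.mem_nhds (ht w hw))).star_star
    rw [show star (starRingEnd ℂ w) = w from star_star w] at h1
    exact h1.differentiableWithinAt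
  · have := congrArg (starRingEnd ℂ) (h.null _ (ht w hw))
    simpa [map_sum] using this
  · have h1 := (h.hasFDerivAt _ (ht w hw) k).comp w Complex.conjCLE.hasFDerivAt
    refine h1.congr_fderiv ?_
    ext1 z
    simp

theorem IsConformalChart.differential_apply {f : M → E3} {ζ : OpenPartialHomeomorph M ℂ}
    {G : Fin 3 → ℂ → ℂ} (h : IsConformalChart f ζ G) (hf : ContMDiff (𝓡 2) 𝓘(ℝ, E3) ∞ f) {p : M}
    (hp : p ∈ ζ.source) (v : TangentSpace (𝓡 2) p) :
    ∃ x : ℂ, ∀ k, differential f p v k = (G k (ζ p) * x).re := by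
  refine ⟨mfderiv (𝓡 2) 𝓘(ℝ, ℂ) ζ p v, fun k => ?_⟩
  have h1 : HasMFDerivAt (𝓡 2) 𝓘(ℝ, ℂ) ζ p _ :=
    ((h.contMDiffOn.contMDiffAt (ζ.open_source.mem_nhds hp)).mdifferentiableAt (by simp)).hasMFDerivAt
  have h2 := (h.hasFDerivAt _ (ζ.map_source hp) k).hasMFDerivAt.comp p h1
  have h3 : HasMFDerivAt (𝓡 2) 𝓘(ℝ, E3) f p (differential f p) :=
    (hf.mdifferentiableAt (by simp)).hasMFDerivAt
  have h4 := (EuclideanSpace.proj k : E3 →L[ℝ] ℝ).hasFDerivAt.hasMFDerivAt.comp p h3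
  have h5 : (EuclideanSpace.proj k : E3 →L[ℝ] ℝ) ∘ f =ᶠ[𝓝 p] (fun z => f (ζ.symm z) k) ∘ ζ := by
    filter_upwards [ζ.open_source.mem_nhds hp] with q hq
    simp [ζ.left_inv hq]
  have h6 := hasMFDerivAt_unique (h4.congr_of_eventuallyEq h5.symm) h2
  exact congrArg (fun L => L v) h6

/-! ### Curves with prescribed complex velocity -/

/-- At the parameter `s`, the curve `Γ` in the surface has an image in `ℝ³` with velocity `Re V`,
and `Im V` is tangent to the surface. -/
structure IsLiftAt (f : M → E3) (V : Fin 3 → ℂ) (Γ : ℝ → M) (s : ℝ) : Prop where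
  contMDiffAt : ContMDiffAt 𝓘(ℝ, ℝ) (𝓡 2) 1 Γ s
  hasDerivAt : ∀ k, HasDerivAt (fun t => f (Γ t) k) (V k).re s
  tangent : ∃ v : TangentSpace (𝓡 2) (Γ s), ∀ k, differential f (Γ s) v k = (V k).im

end Chart

theorem null_vector_eq_or_conj_eq {g V : Fin 3 → ℂ} {j : Fin 3} {x y : ℂ} (hg : ∑ k, g k ^ 2 = 0)
    (hgj : g j = 1) (hV : ∑ k, V k ^ 2 = 0) (hre : ∀ k, (V k).re = (g k * x).re)
    (him : ∀ k, (V k).im = (g k * y).re) :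
    (∀ k, V k = g k * x) ∨ ∀ k, starRingEnd ℂ (V k) = g k * x := by
  have hN : 0 < ∑ k, Complex.normSq (g k) := by
    refine Finset.sum_pos' (fun k _ => Complex.normSq_nonneg _) ⟨j, Finset.mem_univ _, ?_⟩
    simp [hgj]
  have hg1 := congrArg Complex.re hg
  have hg2 := congrArg Complex.im hg
  have hV1 := congrArg Complex.re hV
  have hV2 := congrArg Complex.im hV
  simp only [Fin.sum_univ_three, Complex.normSq_apply, pow_two, Complex.add_re, Complex.add_im,
    Complex.mul_re, Complex.mul_im, Complex.zero_re, Complex.zero_im] at hN hg1 hg2 hV1 hV2 hre him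
  set N := (g 0).re * (g 0).re + (g 0).im * (g 0).im + ((g 1).re * (g 1).re + (g 1).im * (g 1).im) +
    ((g 2).re * (g 2).re + (g 2).im * (g 2).im) with hNdef
  have horth : x.re * y.re + x.im * y.im = 0 := by
    have : N * (x.re * y.re + x.im * y.im) = 0 := by
      simp only [hre, him] at hV2
      rw [hNdef]
      linear_combination hV2 - (x.re * y.re - x.im * y.im) * hg1 + (x.re * y.im + x.im * y.re) * hg2
    exact (mul_eq_zero.1 this).resolve_left hN.ne'
  have hnorm : x.re ^ 2 + x.im ^ 2 = y.re ^ 2 + y.im ^ 2 := by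
    have : N * (x.re ^ 2 + x.im ^ 2 - (y.re ^ 2 + y.im ^ 2)) = 0 := by
      simp only [hre, him] at hV1
      rw [hNdef]
      linear_combination 2 * hV1 - (x.re ^ 2 - x.im ^ 2 - y.re ^ 2 + y.im ^ 2) * hg1 +
        2 * (x.re * x.im - y.re * y.im) * hg2
    linarith [(mul_eq_zero.1 this).resolve_left hN.ne']
  have hsq : y ^ 2 + x ^ 2 = 0 := by
    by_cases hy : y = 0
    · subst hy
      have hx : Complex.normSq x = 0 := by
        rw [Complex.normSq_apply]; simp at hnorm; linarith
      simp [Complex.normSq_eq_zero.1 hx]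
    · have h1 : x * starRingEnd ℂ y = ((x.im * y.re - x.re * y.im : ℝ) : ℂ) * Complex.I := by
        apply Complex.ext
        · simp; linarith
        · simp; ring
      have h2 : x * starRingEnd ℂ x = y * starRingEnd ℂ y := by
        rw [Complex.mul_conj, Complex.mul_conj, Complex.normSq_apply, Complex.normSq_apply]
        congr 1; linarith
      have h3 : starRingEnd ℂ x * y = -(x * starRingEnd ℂ y) := by
        apply Complex.ext
        · simp; linarith
        · simp; ring
      have hy' : starRingEnd ℂ y ≠ 0 := by simpa using hy
      have : (y ^ 2 + x ^ 2) * starRingEnd ℂ y = 0 := by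
        linear_combination (-y) * h2 + x * h3
      exact (mul_eq_zero.1 this).resolve_right hy'
  have hfac : (y + Complex.I * x) * (y - Complex.I * x) = 0 := by
    linear_combination hsq - x ^ 2 * Complex.I_sq
  rcases mul_eq_zero.1 hfac with hc | hc
  · left
    intro k
    have hy : y = -(Complex.I * x) := by linear_combination hc
    apply Complex.ext
    · simpa using hre k
    · rw [him k, hy]; simp
  · right
    intro k
    have hy : y = Complex.I * x := by linear_combination hc
    apply Complex.ext
    · simpa using hre k
    · simp only [Complex.conj_im]; rw [him k, hy]; simp; ring

section Adapted

variable {M : Type*} [TopologicalSpace M] [ChartedSpace E2 M]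

/-- Around the limit of a curve with complex velocity `V` there is a conformal chart in which the
coordinate of the curve has velocity `V j` and `V` is a multiple of the null curve's derivative. -/
theorem IsMinimalImmersion.exists_adapted_chart [IsManifold (𝓡 2) ∞ M] {f : M → E3}
    (hf : IsMinimalImmersion f) {Γ : ℝ → M} {V : Fin 3 → ℝ → ℂ} {b : ℝ} {p : M}
    (hlim : Filter.Tendsto Γ (𝓝[<] b) (𝓝 p))
    (hlift : ∀ᶠ s in 𝓝[<] b, IsLiftAt f (fun k => V k s) Γ s)
    (hcont : ∀ᶠ s in 𝓝[<] b, ∀ k, ContinuousAt (V k) s)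
    (hnull : ∀ᶠ s in 𝓝[<] b, ∑ k, V k s ^ 2 = 0) (hne : ∀ᶠ s in 𝓝[<] b, ∃ k, V k s ≠ 0) :
    ∃ (ζ : OpenPartialHomeomorph M ℂ) (G : Fin 3 → ℂ → ℂ) (j : Fin 3),
      IsConformalChart f ζ G ∧ p ∈ ζ.source ∧ (∀ w ∈ ζ.target, G j w = 1) ∧
      ∀ᶠ s in 𝓝[<] b, Γ s ∈ ζ.source ∧ HasDerivAt (fun t => ζ (Γ t)) (V j s) s ∧
        ∀ k, V k s = G k (ζ (Γ s)) * V j s := by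
  obtain ⟨ζ, G, j, hζ, hp, hj⟩ := hf.exists_isConformalChart p
  have hsrc : ∀ᶠ s in 𝓝[<] b, Γ s ∈ ζ.source := hlim (ζ.open_source.mem_nhds hp)
  obtain ⟨c, hc, hall⟩ := (mem_nhdsLT_iff_exists_Ioo_subset (a := b)).1
    (hsrc.and (hlift.and (hcont.and (hnull.and hne))))
  have hw : ∀ s ∈ Set.Ioo c b, ∃ x : ℂ, HasDerivAt (fun t => ζ (Γ t)) x s ∧
      ((∀ k, V k s = G k (ζ (Γ s)) * x) ∨ ∀ k, starRingEnd ℂ (V k s) = G k (ζ (Γ s)) * x) := by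
    intro s hs
    obtain ⟨h1, h2, -, h4, -⟩ := hall hs
    have hd : ContMDiffAt 𝓘(ℝ, ℝ) 𝓘(ℝ, ℂ) 1 (fun t => ζ (Γ t)) s :=
      (hζ.contMDiffOn.contMDiffAt (ζ.open_source.mem_nhds h1)).comp s h2.contMDiffAt
    have hd2 := (hd.contDiffAt.differentiableAt (by simp)).hasDerivAt
    obtain ⟨v, hv⟩ := h2.tangent
    obtain ⟨y, hy⟩ := hζ.differential_apply hf.smooth h1 v
    refine ⟨_, hd2, null_vector_eq_or_conj_eq (j := j) (hζ.null _ (ζ.map_source h1))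
      (hj _ (ζ.map_source h1)) h4 (fun k => ?_) (fun k => (hv k).symm.trans (hy k))⟩
    have h5 := (hζ.hasFDerivAt _ (ζ.map_source h1) k).comp_hasDerivAt s hd2
    refine (h2.hasDerivAt k).unique (h5.congr_of_eventuallyEq ?_)
    filter_upwards [h2.contMDiffAt.continuousAt (ζ.open_source.mem_nhds h1)] with t ht
    simp [ζ.left_inv ht]
  set D₁ : ℝ → ℝ := fun s => ∑ k, ‖V k s - G k (ζ (Γ s)) * V j s‖ with hD₁
  set D₂ : ℝ → ℝ := fun s =>
    ∑ k, ‖starRingEnd ℂ (V k s) - G k (ζ (Γ s)) * starRingEnd ℂ (V j s)‖ with hD₂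
  have hcV : ∀ k, ContinuousOn (V k) (Set.Ioo c b) := fun k s hs =>
    ((hall hs).2.2.1 k).continuousWithinAt
  have hcG : ∀ k, ContinuousOn (fun s => G k (ζ (Γ s))) (Set.Ioo c b) := fun k s hs => by
    obtain ⟨x, hx, -⟩ := hw s hs
    exact ((((hζ.differentiableOn k).differentiableAt (ζ.open_target.mem_nhds
      (ζ.map_source (hall hs).1))).continuousAt).comp (f := fun s => ζ (Γ s))
        hx.continuousAt).continuousWithinAt
  have hc1 : ContinuousOn D₁ (Set.Ioo c b) := continuousOn_finsetSum _ fun k _ =>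
    ((hcV k).sub ((hcG k).mul (hcV j))).norm
  have hc2 : ContinuousOn D₂ (Set.Ioo c b) := continuousOn_finsetSum _ fun k _ =>
    (((hcV k).star).sub ((hcG k).mul (hcV j).star)).norm
  have hz1 : ∀ s, D₁ s = 0 → ∀ k, V k s = G k (ζ (Γ s)) * V j s := fun s h k =>
    sub_eq_zero.1 (norm_eq_zero.1 ((Finset.sum_eq_zero_iff_of_nonneg
      (fun _ _ => norm_nonneg _)).1 h k (Finset.mem_univ k)))
  have hz2 : ∀ s, D₂ s = 0 → ∀ k, starRingEnd ℂ (V k s) = G k (ζ (Γ s)) * starRingEnd ℂ (V j s) :=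
    fun s h k => sub_eq_zero.1 (norm_eq_zero.1 ((Finset.sum_eq_zero_iff_of_nonneg
      (fun _ _ => norm_nonneg _)).1 h k (Finset.mem_univ k)))
  have hor : ∀ s ∈ Set.Ioo c b, (HasDerivAt (fun t => ζ (Γ t)) (V j s) s ∧ D₁ s = 0) ∨
      (HasDerivAt (fun t => ζ (Γ t)) (starRingEnd ℂ (V j s)) s ∧ D₂ s = 0) := by
    intro s hs
    obtain ⟨x, hx, h | h⟩ := hw s hs
    · have hxj : V j s = x := by rw [h j, hj _ (ζ.map_source (hall hs).1), one_mul]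
      refine Or.inl ⟨hxj ▸ hx, Finset.sum_eq_zero fun k _ => ?_⟩
      rw [hxj, h k]; simp
    · have hxj : starRingEnd ℂ (V j s) = x := by
        rw [h j, hj _ (ζ.map_source (hall hs).1), one_mul]
      refine Or.inr ⟨hxj ▸ hx, Finset.sum_eq_zero fun k _ => ?_⟩
      rw [hxj, h k]; simp
  have hboth : ∀ s ∈ Set.Ioo c b, D₁ s = 0 → D₂ s = 0 → False := by
    intro s hs h1 h2
    obtain ⟨k₀, hk₀⟩ := (hall hs).2.2.2.2
    have hVj : V j s ≠ 0 := fun h0 => hk₀ (by rw [hz1 s h1 k₀, h0, mul_zero])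
    have hreal : ∀ k, starRingEnd ℂ (G k (ζ (Γ s))) = G k (ζ (Γ s)) := by
      intro k
      have e1 := hz2 s h2 k
      rw [hz1 s h1 k, map_mul] at e1
      exact mul_right_cancel₀ (by simpa using hVj) e1
    have hn := congrArg Complex.re (hζ.null _ (ζ.map_source (hall hs).1))
    have hsum : ∑ k, (G k (ζ (Γ s))).re ^ 2 = 0 := by
      rw [← Complex.zero_re, ← hn, Complex.re_sum]
      refine Finset.sum_congr rfl fun k _ => ?_
      have := Complex.conj_eq_iff_im.1 (hreal k)
      simp [pow_two, this]
    have := (Finset.sum_eq_zero_iff_of_nonneg (fun k _ => sq_nonneg _)).1 hsum j (Finset.mem_univ j)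
    rw [hj _ (ζ.map_source (hall hs).1)] at this
    simp at this
  have hmem : Set.Ioo c b ∈ 𝓝[<] b := Ioo_mem_nhdsLT hc
  have hn1 : ∀ s, 0 ≤ D₁ s := fun s => Finset.sum_nonneg fun _ _ => norm_nonneg _
  have hn2 : ∀ s, 0 ≤ D₂ s := fun s => Finset.sum_nonneg fun _ _ => norm_nonneg _
  rcases isPreconnected_Ioo.eq_or_eq_neg_of_sq_eq (f := fun s => D₁ s - D₂ s)
    (g := fun s => D₁ s + D₂ s) (hc1.sub hc2) (hc1.add hc2) (fun s hs => by
      rcases hor s hs with h | h <;> simp [h.2]) (fun {s} hs h0 => by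
        exact hboth s hs (by linarith [hn1 s, hn2 s, h0]) (by linarith [hn1 s, hn2 s, h0]))
    with h | h
  · have h2 : ∀ s ∈ Set.Ioo c b, D₂ s = 0 := fun s hs => by
      have := h hs; simp only at this; linarith
    refine ⟨ζ.transHomeomorph Complex.conjCLE.toHomeomorph, _, j, hζ.conj, hp, fun w hw => ?_, ?_⟩
    · rw [hj (starRingEnd ℂ w) hw, map_one]
    · filter_upwards [hmem] with s hs
      refine ⟨(hall hs).1, ?_, fun k => ?_⟩
      · have hd := ((hor s hs).resolve_left fun h' => hboth s hs h'.2 (h2 s hs)).1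
        have := HasDerivAt.star hd
        rwa [show star (starRingEnd ℂ (V j s)) = V j s from star_star _] at this
      · change _ = starRingEnd ℂ (G k (starRingEnd ℂ (starRingEnd ℂ (ζ (Γ s))))) * _
        have := congrArg (starRingEnd ℂ) (hz2 s (h2 s hs) k)
        simpa using this
  · have h1 : ∀ s ∈ Set.Ioo c b, D₁ s = 0 := fun s hs => by
      have := h hs; simp only [Pi.neg_apply] at this; linarith
    refine ⟨ζ, G, j, hζ, hp, hj, ?_⟩
    filter_upwards [hmem] with s hs
    exact ⟨(hall hs).1, ((hor s hs).resolve_right fun h' => hboth s hs (h1 s hs) h'.2).1,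
      hz1 s (h1 s hs)⟩

end Adapted


section Extension

variable {M : Type*} [TopologicalSpace M] [ChartedSpace E2 M]

/-! ### Holomorphic extension of curves -/

/-- A map `Θ` from an open set of the complex plane to the surface, with `f ∘ Θ` the real part of a
holomorphic curve with derivative `V`. -/
structure IsComplexLiftOn (f : M → E3) (V : Fin 3 → ℂ → ℂ) (Θ : ℂ → M) (B : Set ℂ) : Prop where
  contMDiffOn : ContMDiffOn 𝓘(ℝ, ℂ) (𝓡 2) 1 Θ B
  hasFDerivAt : ∀ z ∈ B, ∀ k, HasFDerivAt (fun z => f (Θ z) k) (reMul (V k z)) z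

theorem IsComplexLiftOn.isLiftAt {f : M → E3} {V : Fin 3 → ℂ → ℂ} {Θ : ℂ → M} {B : Set ℂ}
    (h : IsComplexLiftOn f V Θ B) (hB : IsOpen B) (hf : ContMDiff (𝓡 2) 𝓘(ℝ, E3) ∞ f)
    {π : ℝ → ℂ} (hπ : ContDiff ℝ 1 π) {s : ℝ} {d : ℂ} (hd : HasDerivAt π d s) (hs : π s ∈ B) :
    IsLiftAt f (fun k => d * V k (π s)) (fun t => Θ (π t)) s := by
  have hΘ := h.contMDiffOn.contMDiffAt (hB.mem_nhds hs)
  refine ⟨hΘ.comp s hπ.contMDiff.contMDiffAt, fun k => ?_, ?_⟩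
  · have := (h.hasFDerivAt _ hs k).comp_hasDerivAt s hd
    rw [reMul_apply, mul_comm] at this
    exact this
  · have h1 : HasMFDerivAt 𝓘(ℝ, ℂ) (𝓡 2) Θ (π s) _ :=
      (hΘ.mdifferentiableAt (by simp)).hasMFDerivAt
    refine ⟨mfderiv 𝓘(ℝ, ℂ) (𝓡 2) Θ (π s) (-(Complex.I * d) : ℂ), fun k => ?_⟩
    have h3 : HasMFDerivAt (𝓡 2) 𝓘(ℝ, E3) f (Θ (π s)) (differential f (Θ (π s))) :=
      (hf.mdifferentiableAt (by simp)).hasMFDerivAt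
    have h4 := ((EuclideanSpace.proj k : E3 →L[ℝ] ℝ).hasFDerivAt.hasMFDerivAt.comp _ h3).comp _ h1
    have h5 := hasMFDerivAt_unique h4 (h.hasFDerivAt _ hs k).hasMFDerivAt
    have h6 : (differential f (Θ (π s)) (mfderiv 𝓘(ℝ, ℂ) (𝓡 2) Θ (π s) (-(Complex.I * d) : ℂ))) k =
      (V k (π s) * -(Complex.I * d)).re := congrArg (fun L => L (-(Complex.I * d) : ℂ)) h5
    rw [h6]
    simp
    ring

theorem eq_zero_of_deriv_eq_zero_of_tendsto {g : ℝ → ℂ} {b : ℝ}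
    (hg : ∀ᶠ s in 𝓝[<] b, HasDerivAt g 0 s) (hlim : Filter.Tendsto g (𝓝[<] b) (𝓝 0)) :
    ∀ᶠ s in 𝓝[<] b, g s = 0 := by
  obtain ⟨c, hc, hall⟩ := (mem_nhdsLT_iff_exists_Ioo_subset (a := b)).1 hg
  obtain ⟨a, ha⟩ := isOpen_Ioo.exists_is_const_of_deriv_eq_zero isPreconnected_Ioo
    (fun s hs => (hall hs).differentiableAt.differentiableWithinAt)
    (fun s hs => (hall hs).deriv)
  have hmem : Set.Ioo c b ∈ 𝓝[<] b := Ioo_mem_nhdsLT hc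
  have h1 : Filter.Tendsto g (𝓝[<] b) (𝓝 a) :=
    tendsto_const_nhds.congr' (by filter_upwards [hmem] with s hs using (ha s hs).symm)
  have h0 := tendsto_nhds_unique h1 hlim
  filter_upwards [hmem] with s hs
  rw [ha s hs, h0]

/-- A curve in the surface whose complex velocity is the restriction to a segment ending at `z₀` of
a holomorphic null curve's derivative `V` extends holomorphically past `z₀`. -/
theorem IsMinimalImmersion.exists_extension [IsManifold (𝓡 2) ∞ M] {f : M → E3}
    (hf : IsMinimalImmersion f) {Γ : ℝ → M} {V : Fin 3 → ℂ → ℂ} {z₀ d : ℂ} {b : ℝ} {p : M}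
    (hd : d ≠ 0) (hV : ∀ k, ∀ᶠ z in 𝓝 z₀, DifferentiableAt ℂ (V k) z)
    (hnull : ∀ᶠ z in 𝓝 z₀, ∑ k, V k z ^ 2 = 0) (hne : ∀ᶠ z in 𝓝 z₀, ∃ k, V k z ≠ 0)
    (hlim : Filter.Tendsto Γ (𝓝[<] b) (𝓝 p))
    (hlift : ∀ᶠ s in 𝓝[<] b, IsLiftAt f (fun k => d * V k (z₀ + ((s - b : ℝ) : ℂ) * d)) Γ s) :
    ∃ ρ > 0, ∃ Θ : ℂ → M, IsComplexLiftOn f V Θ (Metric.ball z₀ ρ) ∧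
      ∀ᶠ s in 𝓝[<] b, Γ s = Θ (z₀ + ((s - b : ℝ) : ℂ) * d) := by
  set π : ℝ → ℂ := fun s => z₀ + ((s - b : ℝ) : ℂ) * d with hπ
  have hπb : π b = z₀ := by simp [hπ]
  have dπ : ∀ s, HasDerivAt π d s := fun s => by
    have := ((((hasDerivAt_id s).sub_const b).ofReal_comp).mul_const d).const_add z₀
    rw [Complex.ofReal_one, one_mul] at this
    exact this
  have hπlim : Filter.Tendsto π (𝓝[<] b) (𝓝 z₀) := by
    have := (dπ b).continuousAt.tendsto.mono_left (nhdsWithin_le_nhds (s := Set.Iio b))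
    rwa [hπb] at this
  have hπne : Filter.Tendsto π (𝓝[<] b) (𝓝[≠] z₀) := by
    refine tendsto_nhdsWithin_iff.2 ⟨hπlim, ?_⟩
    filter_upwards [self_mem_nhdsWithin] with s hs
    have : ((s - b : ℝ) : ℂ) ≠ 0 := by
      rw [Complex.ofReal_ne_zero]; exact sub_ne_zero.2 (ne_of_lt hs)
    simp [hπ, sub_eq_zero, hd] at this ⊢
    exact this
  obtain ⟨ζ, G, j, hζ, hp, hj, hev⟩ := hf.exists_adapted_chart (V := fun k s => d * V k (π s))
    hlim hlift
    (by
      rw [Filter.eventually_all]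
      intro k
      filter_upwards [hπlim.eventually (hV k)] with s hs
      exact continuousAt_const.mul (hs.continuousAt.comp (f := π) (dπ s).continuousAt))
    (by
      filter_upwards [hπlim.eventually hnull] with s hs
      simp only [mul_pow, ← Finset.mul_sum, hs, mul_zero])
    (by
      filter_upwards [hπlim.eventually hne] with s hs
      obtain ⟨k, hk⟩ := hs
      exact ⟨k, mul_ne_zero hd hk⟩)
  obtain ⟨r, hr, hball⟩ := Metric.eventually_nhds_iff_ball.1 (Filter.eventually_all.2 hV)
  obtain ⟨Ψ, hΨ0, hΨ⟩ := ((DifferentiableOn.isExactOn_ball (f := V j) (c := z₀) (r := r)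
    (fun z hz => (hball z hz j).differentiableWithinAt)).with_val_at z₀ (ζ p))
  have hΨc : ContinuousAt Ψ z₀ := (hΨ z₀ (Metric.mem_ball_self hr)).continuousAt
  obtain ⟨r', hr', hball'⟩ := Metric.eventually_nhds_iff_ball.1
    (hΨc.eventually (ζ.open_target.mem_nhds (hΨ0 ▸ ζ.map_source hp)))
  set ρ := min r r' with hρ
  have hρ0 : 0 < ρ := lt_min hr hr'
  have hs1 : ∀ z ∈ Metric.ball z₀ ρ, z ∈ Metric.ball z₀ r :=
    fun z hz => Metric.ball_subset_ball (min_le_left _ _) hz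
  have hs2 : ∀ z ∈ Metric.ball z₀ ρ, Ψ z ∈ ζ.target :=
    fun z hz => hball' z (Metric.ball_subset_ball (min_le_right _ _) hz)
  have hζΓ : Filter.Tendsto (fun s => ζ (Γ s)) (𝓝[<] b) (𝓝 (ζ p)) :=
    (ζ.continuousAt hp).tendsto.comp hlim
  have hagree : ∀ᶠ s in 𝓝[<] b, ζ (Γ s) - Ψ (π s) = 0 := by
    refine eq_zero_of_deriv_eq_zero_of_tendsto ?_ ?_
    · filter_upwards [hev, hπlim.eventually (Metric.ball_mem_nhds z₀ hr)] with s h1 h2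
      have := h1.2.1.sub ((hΨ _ h2).comp s (dπ s))
      rwa [mul_comm, sub_self] at this
    · have := hζΓ.sub (hΨc.tendsto.comp hπlim)
      rwa [hΨ0, sub_self] at this
  have hident : ∀ k, ∀ z ∈ Metric.ball z₀ ρ, G k (Ψ z) * V j z = V k z := by
    intro k
    have han : AnalyticOnNhd ℂ (fun z => G k (Ψ z) * V j z - V k z) (Metric.ball z₀ ρ) := by
      refine DifferentiableOn.analyticOnNhd (fun z hz => ?_) Metric.isOpen_ball
      have h1 := (hζ.differentiableOn k).differentiableAt (ζ.open_target.mem_nhds (hs2 z hz))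
      exact (((h1.comp z (hΨ z (hs1 z hz)).differentiableAt).mul (hball z (hs1 z hz) j)).sub
        (hball z (hs1 z hz) k)).differentiableWithinAt
    have hfreq : ∃ᶠ z in 𝓝[≠] z₀, G k (Ψ z) * V j z - V k z = 0 := by
      refine hπne.frequently (Filter.Eventually.frequently ?_)
      filter_upwards [hev, hagree] with s h1 h2
      have h3 := h1.2.2 k
      rw [sub_eq_zero.1 h2] at h3
      refine (mul_eq_zero.1 (?_ : d * _ = 0)).resolve_left hd
      linear_combination -h3
    intro z hz
    exact sub_eq_zero.1 (han.eqOn_zero_of_preconnected_of_frequently_eq_zero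
      (convex_ball z₀ ρ).isPreconnected (Metric.mem_ball_self hρ0) hfreq hz)
  refine ⟨ρ, hρ0, fun z => ζ.symm (Ψ z), ⟨?_, fun z hz k => ?_⟩, ?_⟩
  · have hΨs : ContDiffOn ℝ 1 Ψ (Metric.ball z₀ ρ) := by
      have h1 : DifferentiableOn ℂ Ψ (Metric.ball z₀ ρ) := fun z hz =>
        (hΨ z (hs1 z hz)).differentiableAt.differentiableWithinAt
      exact (h1.contDiffOn (n := 1) Metric.isOpen_ball).restrict_scalars ℝ
    exact hζ.contMDiffOn_symm.comp hΨs.contMDiffOn hs2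
  · have h1 := (hζ.hasFDerivAt _ (hs2 z hz) k).comp z
      ((hΨ z (hs1 z hz)).hasFDerivAt.restrictScalars ℝ)
    refine h1.congr_fderiv ?_
    ext1 x
    simp only [ContinuousLinearMap.comp_apply, reMul_apply, ContinuousLinearMap.coe_restrictScalars',
      ContinuousLinearMap.toSpanSingleton_apply, smul_eq_mul, ← hident k z hz]
    ring_nf
  · filter_upwards [hev, hagree] with s h1 h2
    rw [← sub_eq_zero.1 h2, ζ.left_inv h1.1]

end Extension


section Complete

variable {M : Type*} [TopologicalSpace M] [ChartedSpace E2 M]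

/-! ### Limits of curves of finite length -/

theorem IsLiftAt.enorm_differential_le {f : M → E3} (hf : ContMDiff (𝓡 2) 𝓘(ℝ, E3) ∞ f)
    {V : Fin 3 → ℂ} {Γ : ℝ → M} {s C : ℝ} (h : IsLiftAt f V Γ s) (hV : ∀ k, ‖V k‖ ≤ C) :
    ‖differential f (Γ s) (mfderiv 𝓘(ℝ, ℝ) (𝓡 2) Γ s (1 : ℝ))‖ₑ ≤ ENNReal.ofReal (3 * C) := by
  have hΓ : HasMFDerivAt 𝓘(ℝ, ℝ) (𝓡 2) Γ s _ :=
    (h.contMDiffAt.mdifferentiableAt (by simp)).hasMFDerivAt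
  have h3 : HasMFDerivAt (𝓡 2) 𝓘(ℝ, E3) f (Γ s) (differential f (Γ s)) :=
    (hf.mdifferentiableAt (by simp)).hasMFDerivAt
  have key : ∀ k, differential f (Γ s) (mfderiv 𝓘(ℝ, ℝ) (𝓡 2) Γ s (1 : ℝ)) k = (V k).re := by
    intro k
    have h4 := ((EuclideanSpace.proj k : E3 →L[ℝ] ℝ).hasFDerivAt.hasMFDerivAt.comp _ h3).comp _ hΓ
    have h5 := hasMFDerivAt_unique h4 (h.hasDerivAt k).hasFDerivAt.hasMFDerivAt
    refine (congrArg (fun L => L (1 : ℝ)) h5).trans ?_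
    change (1 : ℝ) • (V k).re = _
    exact one_mul _
  set x : E3 := differential f (Γ s) (mfderiv 𝓘(ℝ, ℝ) (𝓡 2) Γ s (1 : ℝ)) with hx
  rw [← ofReal_norm]
  refine ENNReal.ofReal_le_ofReal ?_
  have hb : ∀ k, x k ^ 2 ≤ C ^ 2 := fun k => by
    rw [key k, ← sq_abs]
    have := (Complex.abs_re_le_norm (V k)).trans (hV k)
    gcongr
  have hC : 0 ≤ C := (norm_nonneg _).trans (hV 0)
  refine abs_le_of_sq_le_sq' ?_ (by positivity) |>.2
  rw [EuclideanSpace.norm_sq_eq, Fin.sum_univ_three]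
  simp only [Real.norm_eq_abs, sq_abs]
  nlinarith [hb 0, hb 1, hb 2]

theorem inducedEDist_le_of_isLiftAt {f : M → E3} (hf : ContMDiff (𝓡 2) 𝓘(ℝ, E3) ∞ f)
    {V : ℝ → Fin 3 → ℂ} {Γ : ℝ → M} {s t C : ℝ} (hst : s ≤ t)
    (h : ∀ x ∈ Set.Icc s t, IsLiftAt f (V x) Γ x) (hV : ∀ x ∈ Set.Icc s t, ∀ k, ‖V x k‖ ≤ C) :
    inducedEDist f (Γ s) (Γ t) ≤ ENNReal.ofReal (3 * C) * ENNReal.ofReal (t - s) := by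
  let _ : ∀ x : M, ENorm (TangentSpace (𝓡 2) x) := fun x => ⟨fun v => ‖differential f x v‖ₑ⟩
  have : ∀ x : M, ENormSMulClass ℝ (TangentSpace (𝓡 2) x) := fun x =>
    ⟨fun c v => by
      change ‖differential f x (c • v)‖ₑ = ‖c‖ₑ * ‖differential f x v‖ₑ
      rw [map_smul, enorm_smul]⟩
  have h1 : Manifold.riemannianEDist (𝓡 2) (Γ s) (Γ t) ≤ Manifold.pathELength (𝓡 2) Γ s t :=
    Manifold.riemannianEDist_le_pathELength
      (fun x hx => (h x hx).contMDiffAt.contMDiffWithinAt) rfl rfl hst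
  refine h1.trans ?_
  rw [Manifold.pathELength_eq_lintegral_mfderiv_Icc]
  refine (MeasureTheory.setLIntegral_mono' measurableSet_Icc
    (g := fun _ => ENNReal.ofReal (3 * C)) fun x hx =>
      (h x hx).enorm_differential_le hf (hV x hx)).trans ?_
  simp

theorem inducedEDist_comm {f : M → E3} (p q : M) : inducedEDist f p q = inducedEDist f q p := by
  let _ : ∀ x : M, ENorm (TangentSpace (𝓡 2) x) := fun x => ⟨fun v => ‖differential f x v‖ₑ⟩
  have : ∀ x : M, ENormSMulClass ℝ (TangentSpace (𝓡 2) x) := fun x =>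
    ⟨fun c v => by
      change ‖differential f x (c • v)‖ₑ = ‖c‖ₑ * ‖differential f x v‖ₑ
      rw [map_smul, enorm_smul]⟩
  exact Manifold.riemannianEDist_comm

/-- In a complete surface, a curve with bounded complex velocity has a limit. -/
theorem IsCompleteSurface.exists_tendsto [T2Space M] {f : M → E3} (hcomplete : IsCompleteSurface f)
    (hf : ContMDiff (𝓡 2) 𝓘(ℝ, E3) ∞ f) {V : ℝ → Fin 3 → ℂ} {Γ : ℝ → M} {a b C : ℝ} (hab : a < b)
    (h : ∀ x ∈ Set.Ioo a b, IsLiftAt f (V x) Γ x) (hV : ∀ x ∈ Set.Ioo a b, ∀ k, ‖V x k‖ ≤ C) :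
    ∃ p, Filter.Tendsto Γ (𝓝[<] b) (𝓝 p) := by
  have hC : 0 ≤ C := (norm_nonneg _).trans (hV ((a + b) / 2) ⟨by linarith, by linarith⟩ 0)
  have hdist : ∀ s ∈ Set.Ioo a b, ∀ t ∈ Set.Ioo a b,
      inducedEDist f (Γ s) (Γ t) ≤ ENNReal.ofReal (3 * C * |t - s|) := by
    intro s hs t ht
    rw [ENNReal.ofReal_mul (by positivity)]
    rcases le_total s t with hst | hst
    · rw [abs_of_nonneg (sub_nonneg.2 hst)]
      have hsub : Set.Icc s t ⊆ Set.Ioo a b := Set.Icc_subset_Ioo hs.1 ht.2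
      exact inducedEDist_le_of_isLiftAt hf hst (fun x hx => h x (hsub hx))
        (fun x hx => hV x (hsub hx))
    · rw [abs_sub_comm, abs_of_nonneg (sub_nonneg.2 hst), inducedEDist_comm]
      have hsub : Set.Icc t s ⊆ Set.Ioo a b := Set.Icc_subset_Ioo ht.1 hs.2
      exact inducedEDist_le_of_isLiftAt hf hst (fun x hx => h x (hsub hx))
        (fun x hx => hV x (hsub hx))
  have hseq : ∀ x : ℕ → ℝ, Filter.Tendsto x Filter.atTop (𝓝[<] b) →
      ∃ p, Filter.Tendsto (fun n => Γ (x n)) Filter.atTop (𝓝 p) := by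
    intro x hx
    refine hcomplete _ fun ε hε => ?_
    obtain ⟨δ, hδ0, hδ⟩ : ∃ δ : ℝ, 0 < δ ∧ ENNReal.ofReal (3 * C * δ) < ε := by
      have : Filter.Tendsto (fun δ : ℝ => ENNReal.ofReal (3 * C * δ)) (𝓝[>] 0) (𝓝 0) := by
        have h1 : Continuous fun δ : ℝ => ENNReal.ofReal (3 * C * δ) :=
          ENNReal.continuous_ofReal.comp (continuous_const.mul continuous_id)
        have h2 := h1.tendsto 0
        simp only [mul_zero, ENNReal.ofReal_zero] at h2
        exact h2.mono_left nhdsWithin_le_nhds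
      obtain ⟨δ, h1, h2⟩ := ((this.eventually (gt_mem_nhds hε)).and self_mem_nhdsWithin).exists
      exact ⟨δ, h2, h1⟩
    have hev := hx.eventually (Ioo_mem_nhdsLT (max_lt hab (sub_lt_self b hδ0)))
    obtain ⟨N, hN⟩ := Filter.eventually_atTop.1 hev
    refine ⟨N, fun m hm n hn => ?_⟩
    obtain ⟨h1, h2⟩ := hN m hm
    obtain ⟨h3, h4⟩ := hN n hn
    rw [max_lt_iff] at h1 h3
    refine (hdist _ ⟨h1.1, h2⟩ _ ⟨h3.1, h4⟩).trans_lt (lt_of_le_of_lt ?_ hδ)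
    refine ENNReal.ofReal_le_ofReal ?_
    have : |x n - x m| ≤ δ := abs_le.2 ⟨by linarith, by linarith⟩
    gcongr
  obtain ⟨x₀, hx₀⟩ := Filter.exists_seq_tendsto (𝓝[<] b)
  obtain ⟨p, hp⟩ := hseq x₀ hx₀
  refine ⟨p, Filter.tendsto_of_seq_tendsto fun x hx => ?_⟩
  have hdiv : Filter.Tendsto (fun n : ℕ => n / 2) Filter.atTop Filter.atTop :=
    Nat.tendsto_div_const_atTop (by norm_num)
  obtain ⟨q, hq⟩ := hseq (fun n => if Even n then x₀ (n / 2) else x (n / 2))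
    ((hx₀.comp hdiv).if' (hx.comp hdiv))
  have hmul : Filter.Tendsto (fun n : ℕ => 2 * n) Filter.atTop Filter.atTop :=
    Filter.tendsto_atTop_mono (fun n => by simp only [id]; omega) Filter.tendsto_id
  have hmul' : Filter.Tendsto (fun n : ℕ => 2 * n + 1) Filter.atTop Filter.atTop :=
    Filter.tendsto_atTop_mono (fun n => by simp only [id]; omega) Filter.tendsto_id
  have h1 : Filter.Tendsto (fun n => Γ (x₀ n)) Filter.atTop (𝓝 q) := by
    refine (hq.comp hmul).congr fun n => ?_
    simp
  have h2 : Filter.Tendsto (fun n => Γ (x n)) Filter.atTop (𝓝 q) := by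
    refine (hq.comp hmul').congr fun n => ?_
    have : ¬ Even (2 * n + 1) := by simp
    simp only [Function.comp, if_neg this]
    congr 2
    omega
  rw [tendsto_nhds_unique hp h1]
  exact h2

end Complete


section Continuation

variable {M : Type*} [TopologicalSpace M] [ChartedSpace E2 M]

/-! ### Continuation along a segment -/

theorem IsLiftAt.congr {f : M → E3} {V : Fin 3 → ℂ} {Γ Γ' : ℝ → M} {s : ℝ}
    (h : IsLiftAt f V Γ s) (hΓ : Γ' =ᶠ[𝓝 s] Γ) : IsLiftAt f V Γ' s := by
  refine ⟨h.contMDiffAt.congr_of_eventuallyEq hΓ,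
    fun k => (h.hasDerivAt k).congr_of_eventuallyEq (hΓ.mono fun t ht => by simp only [ht]), ?_⟩
  rw [hΓ.eq_of_nhds]
  exact h.tangent

theorem eqOn_of_isLiftAt [IsManifold (𝓡 2) ∞ M] [T2Space M] {f : M → E3}
    (hf : IsSurfaceImmersion f) {V : ℝ → Fin 3 → ℂ} {Γ Γ' : ℝ → M} {a b s₀ : ℝ}
    (h : ∀ s ∈ Set.Ioo a b, IsLiftAt f (V s) Γ s) (h' : ∀ s ∈ Set.Ioo a b, IsLiftAt f (V s) Γ' s)
    (hs₀ : s₀ ∈ Set.Ioo a b) (heq : Γ s₀ = Γ' s₀) : Set.EqOn Γ Γ' (Set.Ioo a b) := by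
  refine (T2Space.isSeparatedMap f).eqOn_of_comp_eqOn hf.isLocallyInjective isPreconnected_Ioo
    (fun s hs => (h s hs).contMDiffAt.continuousAt.continuousWithinAt)
    (fun s hs => (h' s hs).contMDiffAt.continuousAt.continuousWithinAt) ?_ hs₀ heq
  intro s hs
  ext k
  exact isOpen_Ioo.eqOn_of_deriv_eq isPreconnected_Ioo
    (fun s hs => ((h s hs).hasDerivAt k).differentiableAt.differentiableWithinAt)
    (fun s hs => ((h' s hs).hasDerivAt k).differentiableAt.differentiableWithinAt)
    (fun s hs => by rw [((h s hs).hasDerivAt k).deriv, ((h' s hs).hasDerivAt k).deriv])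
    hs₀ (by simp only [heq]) hs

theorem exists_glued_lift [IsManifold (𝓡 2) ∞ M] [T2Space M] {f : M → E3}
    (hf : IsSurfaceImmersion f) {V : ℝ → Fin 3 → ℂ} {a β : ℝ} {q : M} (hβ : a < β) {S : Set ℝ}
    (hS : ∀ σ ∈ S, β < σ ∧ ∃ Γ : ℝ → M, (∀ s ∈ Set.Ioo a σ, IsLiftAt f (V s) Γ s) ∧ Γ β = q)
    {τ : ℝ} (hτ : IsLUB S τ) (hβτ : β < τ) :
    ∃ Γ : ℝ → M, (∀ s ∈ Set.Ioo a τ, IsLiftAt f (V s) Γ s) ∧ Γ β = q := by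
  have : Nonempty M := ⟨q⟩
  choose! hlt Λ hΛ hΛβ using hS
  have hex : ∀ s, s < τ → ∃ σ ∈ S, s < σ := fun s hs => by
    obtain ⟨σ, hσ, h, -⟩ := hτ.exists_between hs
    exact ⟨σ, hσ, h⟩
  choose! σ hσS hσ using hex
  have hagree : ∀ σ₁ ∈ S, ∀ s ∈ Set.Ioo a σ₁, s < τ → Λ (σ s) s = Λ σ₁ s := by
    intro σ₁ h₁ s hs hsτ
    refine eqOn_of_isLiftAt hf (V := V) (a := a) (b := min (σ s) σ₁) (s₀ := β) (fun t ht => ?_)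
      (fun t ht => ?_) ?_ ?_ ?_
    · exact hΛ _ (hσS s hsτ) t ⟨ht.1, ht.2.trans_le (min_le_left _ _)⟩
    · exact hΛ _ h₁ t ⟨ht.1, ht.2.trans_le (min_le_right _ _)⟩
    · exact ⟨hβ, lt_min (hlt _ (hσS s hsτ)) (hlt _ h₁)⟩
    · rw [hΛβ _ (hσS s hsτ), hΛβ _ h₁]
    · exact ⟨hs.1, lt_min (hσ s hsτ) hs.2⟩
  refine ⟨fun s => Λ (σ s) s, fun s hs => ?_, ?_⟩
  · have h1 := hΛ _ (hσS s hs.2) s ⟨hs.1, hσ s hs.2⟩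
    refine h1.congr ?_
    filter_upwards [Ioo_mem_nhds hs.1 (lt_min (hσ s hs.2) hs.2)] with t ht
    exact hagree _ (hσS s hs.2) t ⟨ht.1, ht.2.trans_le (min_le_left _ _)⟩
      (ht.2.trans_le (min_le_right _ _))
  · exact hΛβ _ (hσS β hβτ)

/-- A curve along the negative real axis in a complete minimal surface, whose complex velocity is
given by a holomorphic null curve's derivative `V`, continues along the imaginary axis as long as
`V` is holomorphic there. -/
theorem IsMinimalImmersion.exists_continuation [IsManifold (𝓡 2) ∞ M] [T2Space M] {f : M → E3}
    (hf : IsMinimalImmersion f) (hcomplete : IsCompleteSurface f) {V : Fin 3 → ℂ → ℂ} {b C : ℝ}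
    (hb : 0 < b)
    (hV : ∀ s ∈ Set.Ico 0 b, ∀ k, ∀ᶠ z in 𝓝 ((s : ℂ) * Complex.I), DifferentiableAt ℂ (V k) z)
    (hnull : ∀ z, ∑ k, V k z ^ 2 = 0)
    (hne : ∀ s ∈ Set.Ico 0 b, ∀ᶠ z in 𝓝 ((s : ℂ) * Complex.I), ∃ k, V k z ≠ 0)
    (hC : ∀ s ∈ Set.Ioo 0 b, ∀ k, ‖Complex.I * V k (s * Complex.I)‖ ≤ C)
    {γ : ℝ → M} {p : M} (hlim : Filter.Tendsto γ (𝓝[<] 0) (𝓝 p))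
    (hγ : ∀ᶠ t : ℝ in 𝓝[<] 0, IsLiftAt f (fun k => V k (t : ℂ)) γ t) :
    ∃ (Γ : ℝ → M) (q : M), Filter.Tendsto Γ (𝓝[<] b) (𝓝 q) ∧
      ∀ s ∈ Set.Ioo 0 b, IsLiftAt f (fun k => Complex.I * V k (s * Complex.I)) Γ s := by
  have hπ : ContDiff ℝ 1 fun s : ℝ => (s : ℂ) * Complex.I :=
    Complex.ofRealCLM.contDiff.mul contDiff_const
  have dπ : ∀ s : ℝ, HasDerivAt (fun s : ℝ => (s : ℂ) * Complex.I) Complex.I s := fun s => by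
    simpa using ((hasDerivAt_id s).ofReal_comp).mul_const Complex.I
  obtain ⟨ρ, hρ, Θ, hΘ, -⟩ := hf.exists_extension (z₀ := 0) (d := 1) (b := 0) one_ne_zero
    (by simpa using hV 0 ⟨le_rfl, hb⟩) (Filter.Eventually.of_forall hnull)
    (by simpa using hne 0 ⟨le_rfl, hb⟩) hlim (by simpa using hγ)
  set S : Set ℝ := {σ | (min ρ b / 2 < σ ∧ ∃ Γ : ℝ → M, (∀ s ∈ Set.Ioo 0 σ,
    IsLiftAt f (fun k => Complex.I * V k (s * Complex.I)) Γ s) ∧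
    Γ (min ρ b / 2) = Θ ((min ρ b / 2 : ℝ) * Complex.I)) ∧ σ ≤ b} with hS
  have hmin : 0 < min ρ b := lt_min hρ hb
  have hmem : min ρ b ∈ S := by
    refine ⟨⟨by linarith, fun s => Θ (s * Complex.I), fun s hs => ?_, rfl⟩, min_le_right _ _⟩
    refine hΘ.isLiftAt Metric.isOpen_ball hf.smooth hπ (dπ s) ?_
    simp only [Metric.mem_ball, dist_zero_right, norm_mul, Complex.norm_I, mul_one,
      Complex.norm_real, Real.norm_eq_abs]
    rw [abs_of_pos hs.1]
    exact hs.2.trans_le (min_le_left _ _)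
  have hbdd : BddAbove S := ⟨b, fun σ hσ => hσ.2⟩
  have hlub := isLUB_csSup ⟨_, hmem⟩ hbdd
  set τ := sSup S with hτ
  have h1 : min ρ b ≤ τ := hlub.1 hmem
  have h2 : τ ≤ b := hlub.2 fun σ hσ => hσ.2
  obtain ⟨Γ, hΓ, hΓβ⟩ := exists_glued_lift hf.toIsSurfaceImmersion
    (V := fun s k => Complex.I * V k (s * Complex.I)) (half_pos hmin) (fun σ hσ => hσ.1) hlub
    (by linarith)
  have hτ0 : 0 < τ := hmin.trans_le h1
  obtain ⟨q, hq⟩ := hcomplete.exists_tendsto hf.smooth hτ0 hΓ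
    (fun s hs => hC s ⟨hs.1, hs.2.trans_le h2⟩)
  rcases h2.eq_or_lt with h2 | h2
  · rw [h2] at hq hΓ
    exact ⟨Γ, q, hq, hΓ⟩
  exfalso
  have hpath : ∀ s : ℝ, (τ : ℂ) * Complex.I + ((s - τ : ℝ) : ℂ) * Complex.I = s * Complex.I :=
    fun s => by push_cast; ring
  obtain ⟨r, hr, Θ', hΘ', hag⟩ := hf.exists_extension (z₀ := τ * Complex.I) (d := Complex.I) (b := τ)
    Complex.I_ne_zero (hV τ ⟨hτ0.le, h2⟩) (Filter.Eventually.of_forall hnull)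
    (hne τ ⟨hτ0.le, h2⟩) hq (by
      filter_upwards [Ioo_mem_nhdsLT hτ0] with s hs
      simpa only [hpath] using hΓ s hs)
  simp only [hpath] at hag
  obtain ⟨c, hc, hall⟩ := (mem_nhdsLT_iff_exists_Ioo_subset (a := τ)).1 hag
  set Γ' : ℝ → M := fun s => if s < τ then Γ s else Θ' (s * Complex.I) with hΓ'
  have hmem' : min (τ + r) b ∈ S := by
    refine ⟨⟨by rw [lt_min_iff]; constructor <;> linarith, Γ', fun s hs => ?_, ?_⟩,
      min_le_right _ _⟩
    · by_cases hsτ : s < τ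
      · refine (hΓ s ⟨hs.1, hsτ⟩).congr ?_
        filter_upwards [Iio_mem_nhds hsτ] with t ht
        exact if_pos ht
      · have h3 : IsLiftAt f (fun k => Complex.I * V k (s * Complex.I))
            (fun t => Θ' (t * Complex.I)) s := by
          refine hΘ'.isLiftAt Metric.isOpen_ball hf.smooth hπ (dπ s) ?_
          rw [Metric.mem_ball, dist_eq_norm, ← sub_mul, norm_mul, Complex.norm_I, mul_one,
            ← Complex.ofReal_sub, Complex.norm_real, Real.norm_eq_abs,
            abs_of_nonneg (sub_nonneg.2 (not_lt.1 hsτ))]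
          linarith [hs.2.trans_le (min_le_left _ _)]
        refine h3.congr ?_
        filter_upwards [Ioi_mem_nhds ((show c < τ from hc).trans_le (not_lt.1 hsτ))] with t ht
        by_cases htτ : t < τ
        · simp only [hΓ', if_pos htτ]
          exact hall ⟨ht, htτ⟩
        · simp only [hΓ', if_neg htτ]
    · simp only [hΓ']
      rw [if_pos (by linarith), hΓβ]
  have := hlub.1 hmem'
  rw [min_le_iff] at this
  rcases this with h | h <;> linarith

/-- A complex velocity `L` whose third component vanishes at `b` like a square root cannot be
realized up to `b` by a curve in a minimal surface with a limit at `b`. -/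
theorem IsMinimalImmersion.false_of_sqrt_velocity [IsManifold (𝓡 2) ∞ M] {f : M → E3}
    (hf : IsMinimalImmersion f) {L : Fin 3 → ℝ → ℂ} {Q : ℝ → ℂ} {Q' : ℂ} {b : ℝ}
    (h0 : Differentiable ℝ (L 0)) (h1 : Differentiable ℝ (L 1))
    (hcont : ∀ᶠ s in 𝓝[<] b, ContinuousAt (L 2) s)
    (hnull : ∀ s, ∑ k, L k s ^ 2 = 0) (hne : ∀ᶠ s in 𝓝[<] b, ∃ k, L k s ≠ 0)
    (hend : L 0 b ≠ 0 ∨ L 1 b ≠ 0) (hQ : HasDerivAt Q Q' b) (hQ' : Q' ≠ 0) (hQb : Q b = 0)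
    (hLQ : ∀ s, L 2 s ^ 2 = Q s)
    {Γ : ℝ → M} {p : M} (hlim : Filter.Tendsto Γ (𝓝[<] b) (𝓝 p))
    (hlift : ∀ᶠ s in 𝓝[<] b, IsLiftAt f (fun k => L k s) Γ s) : False := by
  obtain ⟨ζ, G, j, hζ, hp, hj, hev⟩ := hf.exists_adapted_chart hlim hlift
    (by
      filter_upwards [hcont] with s hs k
      fin_cases k
      exacts [h0.continuous.continuousAt, h1.continuous.continuousAt, hs])
    (Filter.Eventually.of_forall hnull) hne
  have hw : Filter.Tendsto (fun s => ζ (Γ s)) (𝓝[<] b) (𝓝 (ζ p)) :=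
    (ζ.continuousAt hp).tendsto.comp hlim
  have hGd : ∀ k, DifferentiableAt ℂ (G k) (ζ p) := fun k =>
    (hζ.differentiableOn k).differentiableAt (ζ.open_target.mem_nhds (ζ.map_source hp))
  have hQlim : Filter.Tendsto Q (𝓝[<] b) (𝓝 0) :=
    hQb ▸ hQ.continuousAt.tendsto.mono_left nhdsWithin_le_nhds
  have hmain : Differentiable ℝ (L j) → False := by
    intro hdj
    set W : ℝ → ℂ := fun s => ζ p + ∫ t in b..s, L j t with hW
    have dW : ∀ s, HasDerivAt W (L j s) s := fun s =>
      (hdj.continuous.integral_hasStrictDerivAt b s).hasDerivAt.const_add _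
    have hWb : W b = ζ p := by simp [hW]
    have hagree : ∀ᶠ s in 𝓝[<] b, ζ (Γ s) - W s = 0 := by
      refine eq_zero_of_deriv_eq_zero_of_tendsto ?_ ?_
      · filter_upwards [hev] with s hs
        have := hs.2.1.sub (dW s)
        rwa [sub_self] at this
      · have := hw.sub ((dW b).continuousAt.tendsto.mono_left (nhdsWithin_le_nhds (s := Set.Iio b)))
        rwa [hWb, sub_self] at this
    have dG : HasDerivAt (fun s => G 2 (W s)) (deriv (G 2) (ζ p) * L j b) b := by
      have h2 : HasDerivAt (G 2) (deriv (G 2) (ζ p)) (W b) := hWb ▸ (hGd 2).hasDerivAt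
      have := h2.comp b (dW b)
      exact this
    have dT := dG.mul (hdj b).hasDerivAt
    have dT2 := dT.pow 2
    have heq : (fun s => (G 2 (W s) * L j s) ^ 2) =ᶠ[𝓝[<] b] Q := by
      filter_upwards [hev, hagree] with s hs hs'
      rw [← hLQ s, hs.2.2 2, sub_eq_zero.1 hs']
    have hT0 : (G 2 (W b) * L j b) ^ 2 = 0 :=
      tendsto_nhds_unique (dT2.continuousAt.tendsto.mono_left nhdsWithin_le_nhds)
        (hQlim.congr' heq.symm)
    have hT0' : G 2 (W b) * L j b = 0 := by simpa using hT0
    have hu := (uniqueDiffWithinAt_Iio b).eq_deriv _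
      ((dT2.hasDerivWithinAt (s := Set.Iio b)).congr_of_eventuallyEq heq.symm (by
        simp [hQb, hT0'])) hQ.hasDerivWithinAt
    simp only [Pi.mul_apply, hT0'] at hu
    simp at hu
    exact hQ' hu.symm
  have hj2 : j = 0 ∨ j = 1 ∨ j = 2 := by fin_cases j <;> simp
  rcases hj2 with rfl | rfl | rfl
  · exact hmain h0
  · exact hmain h1
  · have hL2 : Filter.Tendsto (L 2) (𝓝[<] b) (𝓝 0) := by
      rw [tendsto_zero_iff_norm_tendsto_zero]
      have h2 := (continuous_norm.tendsto (0 : ℂ)).comp hQlim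
      rw [norm_zero] at h2
      have h3 := (Real.continuous_sqrt.tendsto 0).comp h2
      rw [Real.sqrt_zero] at h3
      refine h3.congr fun s => ?_
      simp only [Function.comp, ← hLQ s, norm_pow]
      exact Real.sqrt_sq (norm_nonneg _)
    have hzero : ∀ k, Filter.Tendsto (L k) (𝓝[<] b) (𝓝 0) := by
      intro k
      have h3 := ((hGd k).continuousAt.tendsto.comp hw).mul hL2
      rw [mul_zero] at h3
      exact h3.congr' (by filter_upwards [hev] with s hs using (hs.2.2 k).symm)
    rcases hend with h | h
    · exact h (tendsto_nhds_unique (h0.continuous.continuousAt.tendsto.mono_left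
        nhdsWithin_le_nhds) (hzero 0))
    · exact h (tendsto_nhds_unique (h1.continuous.continuousAt.tendsto.mono_left
        nhdsWithin_le_nhds) (hzero 1))

end Continuation


/-! ### The null curve of an epitrochoid -/

/-- The square of the speed of the epitrochoid, up to the factor `R²`. -/
def speedSq (a m : ℝ) (z : ℂ) : ℂ := 1 + a ^ 2 - 2 * a * Complex.cos (m * z)

/-- The derivative of the holomorphic null curve determined by the epitrochoid as a geodesic, with
`R = r_c + r_m`, `a = λ / r_m` and `m = r_c / r_m`. -/
def velocity (R a m : ℝ) (k : Fin 3) (z : ℂ) : ℂ :=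
  ![R * (-Complex.sin z + a * Complex.sin ((m + 1) * z)),
    R * (Complex.cos z - a * Complex.cos ((m + 1) * z)),
    Complex.I * R * speedSq a m z ^ (2⁻¹ : ℂ)] k

section Velocity

variable (R a m : ℝ)

theorem velocity_zero (z : ℂ) : velocity R a m 0 z =
    R * (-Complex.sin z + a * Complex.sin ((m + 1) * z)) := rfl

theorem velocity_one (z : ℂ) : velocity R a m 1 z =
    R * (Complex.cos z - a * Complex.cos ((m + 1) * z)) := rfl

theorem velocity_two (z : ℂ) : velocity R a m 2 z =
    Complex.I * R * speedSq a m z ^ (2⁻¹ : ℂ) := rfl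

theorem velocity_two_sq (z : ℂ) : velocity R a m 2 z ^ 2 = -(R ^ 2 * speedSq a m z) := by
  have h : (speedSq a m z ^ (2⁻¹ : ℂ)) ^ 2 = speedSq a m z := by
    simp
  rw [velocity_two, mul_pow, mul_pow, h, Complex.I_sq]
  ring

theorem cos_mul_eq (z : ℂ) : Complex.cos (m * z) =
    Complex.cos ((m + 1) * z) * Complex.cos z + Complex.sin ((m + 1) * z) * Complex.sin z := by
  rw [← Complex.cos_sub]
  congr 1
  ring

theorem sum_velocity_sq (z : ℂ) : ∑ k, velocity R a m k z ^ 2 = 0 := by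
  rw [Fin.sum_univ_three, velocity_two_sq, velocity_zero, velocity_one, speedSq, cos_mul_eq]
  linear_combination R ^ 2 * Complex.sin_sq_add_cos_sq z +
    R ^ 2 * a ^ 2 * Complex.sin_sq_add_cos_sq ((m + 1) * z)

theorem differentiable_speedSq : Differentiable ℂ (speedSq a m) := by
  unfold speedSq
  fun_prop

theorem differentiable_velocity_zero : Differentiable ℂ (velocity R a m 0) := by
  have : velocity R a m 0 = fun z => R * (-Complex.sin z + a * Complex.sin ((m + 1) * z)) := rfl
  rw [this]
  fun_prop

theorem differentiable_velocity_one : Differentiable ℂ (velocity R a m 1) := by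
  have : velocity R a m 1 = fun z => R * (Complex.cos z - a * Complex.cos ((m + 1) * z)) := rfl
  rw [this]
  fun_prop

theorem eventually_differentiableAt_velocity {z : ℂ} (hz : speedSq a m z ∈ Complex.slitPlane)
    (k : Fin 3) : ∀ᶠ w in 𝓝 z, DifferentiableAt ℂ (velocity R a m k) w := by
  have hev := (differentiable_speedSq a m).continuous.continuousAt.eventually
    (Complex.isOpen_slitPlane.mem_nhds hz)
  fin_cases k
  · exact Filter.Eventually.of_forall fun w => differentiable_velocity_zero R a m w
  · exact Filter.Eventually.of_forall fun w => differentiable_velocity_one R a m w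
  · filter_upwards [hev] with w hw
    exact (((differentiable_speedSq a m) w).cpow (differentiableAt_const _) hw).const_mul _

theorem eventually_velocity_ne_zero (hR : R ≠ 0) {z : ℂ}
    (hz : speedSq a m z ∈ Complex.slitPlane) : ∀ᶠ w in 𝓝 z, ∃ k, velocity R a m k w ≠ 0 := by
  filter_upwards [(differentiable_speedSq a m).continuous.continuousAt.eventually
    (Complex.isOpen_slitPlane.mem_nhds hz)] with w hw
  refine ⟨2, fun h => ?_⟩
  have h2 := velocity_two_sq R a m w
  rw [h] at h2
  have : (R : ℂ) ^ 2 * speedSq a m w ≠ 0 :=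
    mul_ne_zero (pow_ne_zero 2 (Complex.ofReal_ne_zero.2 hR)) (Complex.slitPlane_ne_zero hw)
  exact this (by linear_combination h2)

/-- The restriction of `speedSq` to the imaginary axis. -/
theorem speedSq_mul_I (s : ℝ) :
    speedSq a m (s * Complex.I) = ((1 + a ^ 2 - 2 * a * Real.cosh (m * s) : ℝ) : ℂ) := by
  rw [speedSq, ← mul_assoc, Complex.cos_mul_I]
  push_cast
  ring

theorem speedSq_ofReal (t : ℝ) :
    speedSq a m t = ((1 + a ^ 2 - 2 * a * Real.cos (m * t) : ℝ) : ℂ) := by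
  rw [speedSq]
  push_cast
  ring

end Velocity

/-- The height on the imaginary axis of the first branch point. -/
def branchHeight (a m : ℝ) : ℝ := |Real.log a| / m

section Branch

variable {R a m : ℝ}

theorem branchHeight_pos (ha : 0 < a) (ha1 : a ≠ 1) (hm : 0 < m) : 0 < branchHeight a m :=
  div_pos (abs_pos.2 (Real.log_ne_zero_of_pos_of_ne_one ha ha1)) hm

theorem cosh_branchHeight (ha : 0 < a) (hm : 0 < m) :
    2 * a * Real.cosh (m * branchHeight a m) = 1 + a ^ 2 := by
  rw [branchHeight, mul_div_cancel₀ _ hm.ne', Real.cosh_abs, Real.cosh_log ha]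
  field_simp
  ring

theorem speedSq_mem_slitPlane (ha : 0 < a) (hm : 0 < m) {s : ℝ}
    (hs : s ∈ Set.Ico 0 (branchHeight a m)) : speedSq a m (s * Complex.I) ∈ Complex.slitPlane := by
  rw [speedSq_mul_I, Complex.ofReal_mem_slitPlane, ← cosh_branchHeight ha hm]
  have h1 : m * s < m * branchHeight a m := mul_lt_mul_of_pos_left hs.2 hm
  have h0 : 0 ≤ m * s := mul_nonneg hm.le hs.1
  have : Real.cosh (m * s) < Real.cosh (m * branchHeight a m) := by
    rw [Real.cosh_lt_cosh, abs_of_nonneg h0, abs_of_nonneg (h0.trans h1.le)]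
    exact h1
  nlinarith

theorem velocity_branch_ne_zero (hR : 0 < R) (ha : 0 < a) (ha1 : a ≠ 1) (s : ℝ) :
    Complex.I * velocity R a m 0 (s * Complex.I) ≠ 0 ∨
      Complex.I * velocity R a m 1 (s * Complex.I) ≠ 0 := by
  by_contra! h
  have h0 : velocity R a m 0 (s * Complex.I) = 0 := by simpa using h.1
  have h1 : velocity R a m 1 (s * Complex.I) = 0 := by simpa using h.2
  have hR' : (R : ℂ) ≠ 0 := Complex.ofReal_ne_zero.2 hR.ne'
  rw [velocity_zero] at h0
  rw [velocity_one] at h1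
  have e0 := (mul_eq_zero.1 h0).resolve_left hR'
  have e1 := (mul_eq_zero.1 h1).resolve_left hR'
  have h2 := Complex.sin_sq_add_cos_sq ((s : ℂ) * Complex.I)
  have h3 := Complex.sin_sq_add_cos_sq ((m + 1) * ((s : ℂ) * Complex.I))
  have h4 : (a : ℂ) ^ 2 = 1 := by
    linear_combination (-(a : ℂ) ^ 2) * h3 + h2 +
      (Complex.sin ((s : ℂ) * Complex.I) + a * Complex.sin ((m + 1) * ((s : ℂ) * Complex.I))) * e0 -
      (Complex.cos ((s : ℂ) * Complex.I) + a * Complex.cos ((m + 1) * ((s : ℂ) * Complex.I))) * e1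
  have h5 : a ^ 2 = 1 := by exact_mod_cast h4
  exact ha1 ((pow_eq_one_iff_of_nonneg ha.le two_ne_zero).1 h5)

theorem exists_velocity_bound (R a m b : ℝ) :
    ∃ C, ∀ s ∈ Set.Ioo 0 b, ∀ k, ‖Complex.I * velocity R a m k (s * Complex.I)‖ ≤ C := by
  have hpath : Continuous fun s : ℝ => (s : ℂ) * Complex.I := by fun_prop
  have hc : ∀ k, Continuous fun s : ℝ => velocity R a m k (s * Complex.I) ^ 2 := by
    intro k
    fin_cases k
    · exact ((differentiable_velocity_zero R a m).continuous.comp hpath).pow 2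
    · exact ((differentiable_velocity_one R a m).continuous.comp hpath).pow 2
    · simp only [Fin.reduceFinMk, velocity_two_sq]
      exact (continuous_const.mul ((differentiable_speedSq a m).continuous.comp hpath)).neg
  have hb : ∀ k, ∃ C, ∀ s ∈ Set.Icc 0 b, ‖velocity R a m k (s * Complex.I) ^ 2‖ ≤ C := fun k =>
    isCompact_Icc.exists_bound_of_continuousOn (hc k).continuousOn
  choose C hC using hb
  refine ⟨1 + ∑ k, |C k|, fun s hs k => ?_⟩
  have h1 := hC k s ⟨hs.1.le, hs.2.le⟩
  have h2 : |C k| ≤ ∑ k, |C k| :=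
    Finset.single_le_sum (f := fun k => |C k|) (fun _ _ => abs_nonneg _) (Finset.mem_univ k)
  rw [norm_pow] at h1
  rw [norm_mul, Complex.norm_I, one_mul]
  nlinarith [le_abs_self (C k), sq_nonneg (‖velocity R a m k (s * Complex.I)‖ - 1),
    norm_nonneg (velocity R a m k (s * Complex.I))]

variable {M : Type*} [TopologicalSpace M] [ChartedSpace E2 M]

/-- No complete minimal surface contains a curve whose complex velocity is the one of the
epitrochoid. -/
theorem IsMinimalImmersion.false_of_velocity [IsManifold (𝓡 2) ∞ M] [T2Space M] {f : M → E3}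
    (hf : IsMinimalImmersion f) (hcomplete : IsCompleteSurface f) (hR : 0 < R) (ha : 0 < a)
    (ha1 : a ≠ 1) (hm : 0 < m) {γ : ℝ → M} (hcont : ContinuousAt γ 0)
    (hγ : ∀ᶠ t : ℝ in 𝓝[<] 0, IsLiftAt f (fun k => velocity R a m k (t : ℂ)) γ t) : False := by
  set b := branchHeight a m with hb
  have hb0 : 0 < b := branchHeight_pos ha ha1 hm
  obtain ⟨C, hC⟩ := exists_velocity_bound R a m b
  obtain ⟨Γ, q, hq, hΓ⟩ := hf.exists_continuation hcomplete hb0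
    (fun s hs k => eventually_differentiableAt_velocity R a m (speedSq_mem_slitPlane ha hm hs) k)
    (sum_velocity_sq R a m)
    (fun s hs => eventually_velocity_ne_zero R a m hR.ne' (speedSq_mem_slitPlane ha hm hs))
    hC (hcont.tendsto.mono_left nhdsWithin_le_nhds) hγ
  have hpath : Differentiable ℝ fun s : ℝ => (s : ℂ) * Complex.I :=
    (Complex.ofRealCLM.differentiable).mul_const _
  have hIoo : Set.Ioo 0 b ∈ 𝓝[<] b := Ioo_mem_nhdsLT hb0
  have hQ : HasDerivAt (fun s : ℝ => ((R ^ 2 * (1 + a ^ 2 - 2 * a * Real.cosh (m * s)) : ℝ) : ℂ))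
      ((R ^ 2 * (-(2 * a * (Real.sinh (m * b) * m))) : ℝ) : ℂ) b := by
    refine HasDerivAt.ofReal_comp ?_
    have h1 : HasDerivAt (fun s : ℝ => m * s) m b := by
      simpa using (hasDerivAt_id b).const_mul m
    simpa using ((h1.cosh.const_mul (2 * a)).const_sub (1 + a ^ 2)).const_mul (R ^ 2)
  refine hf.false_of_sqrt_velocity (L := fun k s => Complex.I * velocity R a m k (s * Complex.I))
    ?_ ?_ ?_ ?_ ?_ (velocity_branch_ne_zero hR ha ha1 b) hQ ?_ ?_ ?_ hq ?_
  · exact (((differentiable_velocity_zero R a m).restrictScalars ℝ).comp hpath).const_mul _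
  · exact (((differentiable_velocity_one R a m).restrictScalars ℝ).comp hpath).const_mul _
  · filter_upwards [hIoo] with s hs
    have h1 := (eventually_differentiableAt_velocity R a m
      (speedSq_mem_slitPlane ha hm ⟨hs.1.le, hs.2⟩) 2).self_of_nhds
    exact continuousAt_const.mul (h1.continuousAt.comp (f := fun s : ℝ => (s : ℂ) * Complex.I)
      (hpath s).continuousAt)
  · intro s
    simp only [mul_pow, ← Finset.mul_sum, sum_velocity_sq, mul_zero]
  · filter_upwards [hIoo] with s hs
    obtain ⟨k, hk⟩ := (eventually_velocity_ne_zero R a m hR.ne'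
      (speedSq_mem_slitPlane ha hm ⟨hs.1.le, hs.2⟩)).self_of_nhds
    exact ⟨k, mul_ne_zero Complex.I_ne_zero hk⟩
  · rw [Complex.ofReal_ne_zero]
    have : 0 < Real.sinh (m * b) := Real.sinh_pos_iff.2 (by positivity)
    have : 0 < R ^ 2 * (2 * a * (Real.sinh (m * b) * m)) := by positivity
    linarith
  · rw [cosh_branchHeight ha hm, sub_self, mul_zero, Complex.ofReal_zero]
  · intro s
    rw [mul_pow, velocity_two_sq, Complex.I_sq, speedSq_mul_I]
    push_cast
    ring
  · filter_upwards [hIoo] with s hs using hΓ s hs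

end Branch


/-! ### The epitrochoid as a geodesic -/

theorem hasDerivAt_e3 {g : ℝ → E3} {g' : E3} {t : ℝ}
    (h : ∀ k, HasDerivAt (fun s => g s k) (g' k) t) : HasDerivAt g g' t := by
  have := (PiLp.hasFDerivAt_toLp (𝕜 := ℝ) 2 (fun k => g t k)).comp_hasDerivAt
    (f := fun s k => g s k) t (hasDerivAt_pi.2 h)
  exact this

/-- The velocity of the epitrochoid with `R = r_c + r_m`, `a = λ / r_m`, `m = r_c / r_m`. -/
def epiVelocity (R a m t : ℝ) : E3 :=
  !₂[R * (-Real.sin t + a * Real.sin ((m + 1) * t)),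
    R * (Real.cos t - a * Real.cos ((m + 1) * t)), 0]

/-- The acceleration of the epitrochoid. -/
def epiAcceleration (R a m t : ℝ) : E3 :=
  !₂[R * (-Real.cos t + a * ((m + 1) * Real.cos ((m + 1) * t))),
    R * (-Real.sin t + a * ((m + 1) * Real.sin ((m + 1) * t))), 0]

theorem hasDerivAt_epitrochoid {rc rm : ℝ} (hrm : 0 < rm) (lam t : ℝ) :
    HasDerivAt (epitrochoid rc rm lam) (epiVelocity (rc + rm) (lam / rm) (rc / rm) t) t := by
  have hq : (rc + rm) / rm = rc / rm + 1 := by field_simp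
  have h1 : HasDerivAt (fun t : ℝ => (rc / rm + 1) * t) (rc / rm + 1) t := by
    simpa using (hasDerivAt_id t).const_mul (rc / rm + 1)
  refine hasDerivAt_e3 fun k => ?_
  fin_cases k
  · simp only [epitrochoid, epiVelocity, hq]
    refine (((Real.hasDerivAt_cos t).const_mul (rc + rm)).sub
      (h1.cos.const_mul lam)).congr_deriv ?_
    simp
    field_simp
  · simp only [epitrochoid, epiVelocity, hq]
    refine (((Real.hasDerivAt_sin t).const_mul (rc + rm)).sub
      (h1.sin.const_mul lam)).congr_deriv ?_
    simp
    field_simp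
  · exact hasDerivAt_const t 0

theorem hasDerivAt_epiVelocity (R a m t : ℝ) :
    HasDerivAt (epiVelocity R a m) (epiAcceleration R a m t) t := by
  have h1 : HasDerivAt (fun t : ℝ => (m + 1) * t) (m + 1) t := by
    simpa using (hasDerivAt_id t).const_mul (m + 1)
  refine hasDerivAt_e3 fun k => ?_
  fin_cases k
  · refine (((Real.hasDerivAt_sin t).neg.add (h1.sin.const_mul a)).const_mul R).congr_deriv ?_
    change _ = R * (-Real.cos t + a * ((m + 1) * Real.cos ((m + 1) * t)))
    ring
  · refine (((Real.hasDerivAt_cos t).sub (h1.cos.const_mul a)).const_mul R).congr_deriv ?_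
    change _ = R * (-Real.sin t + a * ((m + 1) * Real.sin ((m + 1) * t)))
    ring
  · exact hasDerivAt_const t 0

theorem epi_det (R a m t : ℝ) :
    epiVelocity R a m t 0 * epiAcceleration R a m t 1 -
      epiVelocity R a m t 1 * epiAcceleration R a m t 0 =
    R ^ 2 * (1 + a ^ 2 * (m + 1) - a * (m + 2) * Real.cos (m * t)) := by
  have h : Real.cos (m * t) = Real.cos ((m + 1) * t) * Real.cos t +
      Real.sin ((m + 1) * t) * Real.sin t := by
    rw [← Real.cos_sub]
    congr 1
    ring
  simp only [epiVelocity, epiAcceleration, h, PiLp.toLp_apply, Matrix.cons_val_zero,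
    Matrix.cons_val_one]
  linear_combination R ^ 2 * Real.sin_sq_add_cos_sq t +
    R ^ 2 * a ^ 2 * (m + 1) * Real.sin_sq_add_cos_sq ((m + 1) * t)

theorem eventually_curvature_ne_zero {a m : ℝ} (ha : 0 < a) (hm : 0 < m) :
    ∀ᶠ t in 𝓝[<] (0 : ℝ), 1 + a ^ 2 * (m + 1) - a * (m + 2) * Real.cos (m * t) ≠ 0 := by
  by_cases h : 1 + a ^ 2 * (m + 1) - a * (m + 2) * Real.cos (m * 0) = 0
  · have hpi : -(Real.pi / m) < 0 := neg_lt_zero.2 (div_pos Real.pi_pos hm)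
    filter_upwards [Ioo_mem_nhdsLT hpi] with t ht
    have h1 : 0 < m * -t := mul_pos hm (neg_pos.2 ht.2)
    have h2 : m * -t ≤ Real.pi := by
      have : -t < Real.pi / m := by linarith [ht.1]
      rw [lt_div_iff₀ hm] at this
      linarith
    have h3 := Real.cos_lt_cos_of_nonneg_of_le_pi le_rfl h2 h1
    rw [mul_neg, Real.cos_neg, Real.cos_zero] at h3
    rw [mul_zero, Real.cos_zero] at h
    have : 0 < a * (m + 2) * (1 - Real.cos (m * t)) :=
      mul_pos (by positivity) (by linarith)
    intro h0
    linarith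
  · have hc : Continuous fun t : ℝ => 1 + a ^ 2 * (m + 1) - a * (m + 2) * Real.cos (m * t) := by
      fun_prop
    exact (hc.continuousAt.eventually_ne h).filter_mono nhdsWithin_le_nhds

theorem speed_pos {a : ℝ} (ha : 0 < a) (ha1 : a ≠ 1) (x : ℝ) :
    0 < 1 + a ^ 2 - 2 * a * Real.cos x := by
  have h1 : 0 < (1 - a) ^ 2 := by
    have : 1 - a ≠ 0 := sub_ne_zero.2 (Ne.symm ha1)
    positivity
  nlinarith [Real.cos_le_one x]

theorem velocity_ofReal_zero (R a m t : ℝ) : velocity R a m 0 t = (epiVelocity R a m t 0 : ℝ) := by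
  rw [velocity_zero]
  simp [epiVelocity]

theorem velocity_ofReal_one (R a m t : ℝ) : velocity R a m 1 t = (epiVelocity R a m t 1 : ℝ) := by
  rw [velocity_one]
  simp [epiVelocity]

theorem velocity_ofReal_two {a : ℝ} (ha : 0 < a) (ha1 : a ≠ 1) (R m t : ℝ) :
    (velocity R a m 2 t).re = 0 := by
  have h := (speed_pos ha ha1 (m * t)).le
  have : speedSq a m t ^ (2⁻¹ : ℂ) =
      (((1 + a ^ 2 - 2 * a * Real.cos (m * t)) ^ (2⁻¹ : ℝ) : ℝ) : ℂ) := by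
    rw [speedSq_ofReal, Complex.ofReal_cpow h]
    simp
  rw [velocity_two, this]
  simp

section Geodesic

variable {M : Type*} [TopologicalSpace M] [ChartedSpace E2 M]

theorem mem_range_differential {f : M → E3} {p : M} (hinj : Function.Injective (differential f p))
    {X e : E3} (hX : X ≠ 0) (horth : ∀ v, inner ℝ X (differential f p v) = 0)
    (he : inner ℝ X e = 0) : ∃ v, differential f p v = e := by
  have hrank : Module.finrank ℝ (LinearMap.range (differential f p).toLinearMap) = 2 := by
    rw [LinearMap.finrank_range_of_inj hinj]
    exact finrank_euclideanSpace_fin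
  have : Fact (Module.finrank ℝ E3 = 2 + 1) := ⟨finrank_euclideanSpace_fin⟩
  have hperp := Submodule.finrank_orthogonal_span_singleton (𝕜 := ℝ) (n := 2) hX
  have hle : LinearMap.range (differential f p).toLinearMap ≤ (ℝ ∙ X)ᗮ := by
    rintro _ ⟨v, rfl⟩
    exact Submodule.mem_orthogonal_singleton_iff_inner_right.2 (horth v)
  have heq := Submodule.eq_of_le_of_finrank_eq hle (hrank.trans hperp.symm)
  have hmem : e ∈ (ℝ ∙ X)ᗮ := Submodule.mem_orthogonal_singleton_iff_inner_right.2 he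
  rw [← heq] at hmem
  exact hmem

theorem IsGeodesicCurve.isLiftAt_epitrochoid {f : M → E3} (hf : IsSurfaceImmersion f) {γ : ℝ → M}
    (hγ : IsGeodesicCurve f γ) {rc rm lam : ℝ} (hrm : 0 < rm) (hlam : 0 < lam) (hreg : lam ≠ rm)
    (hc : ∀ t, f (γ t) = epitrochoid rc rm lam t) {t : ℝ} (hR : rc + rm ≠ 0)
    (hcurv : 1 + (lam / rm) ^ 2 * (rc / rm + 1) -
      lam / rm * (rc / rm + 2) * Real.cos (rc / rm * t) ≠ 0) :
    IsLiftAt f (fun k => velocity (rc + rm) (lam / rm) (rc / rm) k t) γ t := by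
  have ha : 0 < lam / rm := div_pos hlam hrm
  have ha1 : lam / rm ≠ 1 := fun h => hreg ((div_eq_one_iff_eq hrm.ne').1 h)
  set R := rc + rm
  set a := lam / rm
  set m := rc / rm
  have hfc : f ∘ γ = epitrochoid rc rm lam := funext hc
  have d1 : deriv (f ∘ γ) = epiVelocity R a m := by
    rw [hfc]
    exact funext fun t => (hasDerivAt_epitrochoid hrm lam t).deriv
  have d2 : deriv (deriv (f ∘ γ)) t = epiAcceleration R a m t := by
    rw [d1]
    exact (hasDerivAt_epiVelocity R a m t).deriv
  refine ⟨hγ.smooth.contMDiffAt.of_le (by simp), fun k => ?_, ?_⟩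
  · have h1 : HasDerivAt (fun t => f (γ t) k) (epiVelocity R a m t k) t := by
      simp only [hc]
      exact (EuclideanSpace.proj k : E3 →L[ℝ] ℝ).hasFDerivAt.comp_hasDerivAt t
        (hasDerivAt_epitrochoid hrm lam t)
    refine h1.congr_deriv ?_
    fin_cases k
    · exact (congrArg Complex.re (velocity_ofReal_zero R a m t)).symm
    · exact (congrArg Complex.re (velocity_ofReal_one R a m t)).symm
    · exact (velocity_ofReal_two ha ha1 R m t).symm
  · obtain ⟨μ, hμ⟩ := hγ.acceleration t
    rw [d2, d1] at hμ
    have hX : epiAcceleration R a m t - μ • epiVelocity R a m t ≠ 0 := by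
      intro h0
      have h1 := sub_eq_zero.1 h0
      have hdet := epi_det R a m t
      rw [h1] at hdet
      simp only [PiLp.smul_apply, smul_eq_mul] at hdet
      have : R ^ 2 * (1 + a ^ 2 * (m + 1) - a * (m + 2) * Real.cos (m * t)) = 0 := by
        rw [← hdet]
        ring
      exact (mul_ne_zero (pow_ne_zero 2 hR) hcurv) this
    obtain ⟨v, hv⟩ := mem_range_differential (hf.injective_differential _) hX hμ
      (e := !₂[0, 0, (velocity R a m 2 t).im]) (by
        rw [inner_e3]
        simp [epiAcceleration, epiVelocity])
    refine ⟨v, fun k => ?_⟩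
    rw [hv]
    fin_cases k
    · exact (congrArg Complex.im (velocity_ofReal_zero R a m t)).symm
    · exact (congrArg Complex.im (velocity_ofReal_one R a m t)).symm
    · rfl

theorem not_containsAsGeodesic_epitrochoid [IsManifold (𝓡 2) ∞ M] [T2Space M] {f : M → E3}
    (hmin : IsMinimalImmersion f) (hcomplete : IsCompleteSurface f) {rc rm lam : ℝ} (hrc : 0 < rc)
    (hrm : 0 < rm) (hlam : 0 < lam) (hreg : lam ≠ rm) :
    ¬ ContainsAsGeodesic f (epitrochoid rc rm lam) := by
  rintro ⟨γ, hγ, hc⟩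
  have ha : 0 < lam / rm := div_pos hlam hrm
  have hm : 0 < rc / rm := div_pos hrc hrm
  refine hmin.false_of_velocity hcomplete (add_pos hrc hrm) ha
    (fun h => hreg ((div_eq_one_iff_eq hrm.ne').1 h)) hm hγ.smooth.continuous.continuousAt ?_
  filter_upwards [eventually_curvature_ne_zero ha hm] with t ht
  exact hγ.isLiftAt_epitrochoid hmin.toIsSurfaceImmersion hrm hlam hreg hc (add_pos hrc hrm).ne' ht

end Geodesic

/-! ### Rigid motions -/

section Motion

variable (B : E3 ≃ᵃⁱ[ℝ] E3)

theorem motion_apply (x : E3) : B x = B.linearIsometryEquiv x + B 0 := by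
  simpa using B.map_vadd 0 x

theorem fderiv_motion_comp {W : Type*} [NormedAddCommGroup W] [NormedSpace ℝ W] (F : W → E3)
    (u w : W) : fderiv ℝ (B ∘ F) u w = B.linearIsometryEquiv (fderiv ℝ F u w) := by
  have h : B ∘ F = fun x => (B.linearIsometryEquiv ∘ F) x + B 0 :=
    funext fun x => motion_apply B (F x)
  rw [h, fderiv_add_const, LinearIsometryEquiv.comp_fderiv]
  rfl

theorem partialDeriv_motion_comp (F : E2 → E3) (i : Fin 2) :
    partialDeriv i (B ∘ F) = B.linearIsometryEquiv ∘ partialDeriv i F :=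
  funext fun u => fderiv_motion_comp B F u _

theorem partialDeriv_linear_comp (L : E3 ≃ₗᵢ[ℝ] E3) (F : E2 → E3) (i : Fin 2) (u : E2) :
    partialDeriv i (L ∘ F) u = L (partialDeriv i F u) := by
  unfold partialDeriv
  rw [LinearIsometryEquiv.comp_fderiv]
  rfl

theorem meanCurvature_motion_comp (F : E2 → E3) (ν : E3) (u : E2) :
    meanCurvature (B ∘ F) (B.linearIsometryEquiv ν) u = meanCurvature F ν u := by
  simp only [meanCurvature, firstForm, secondForm, partialDeriv_motion_comp, partialDeriv_linear_comp,
    Function.comp_apply, LinearIsometryEquiv.inner_map_map]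

variable {M : Type*} [TopologicalSpace M] [ChartedSpace E2 M]

theorem differential_motion_comp {f : M → E3} (hf : ContMDiff (𝓡 2) 𝓘(ℝ, E3) ∞ f) (p : M)
    (v : TangentSpace (𝓡 2) p) :
    differential (B ∘ f) p v = B.linearIsometryEquiv (differential f p v) := by
  have hB : HasFDerivAt B (B.linearIsometryEquiv : E3 →L[ℝ] E3) (f p) := by
    have h : (B : E3 → E3) = fun x => B.linearIsometryEquiv x + B 0 := funext (motion_apply B)
    rw [h]
    exact B.linearIsometryEquiv.toContinuousLinearEquiv.hasFDerivAt.add_const _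
  have h3 : HasMFDerivAt (𝓡 2) 𝓘(ℝ, E3) f p (differential f p) :=
    (hf.mdifferentiableAt (by simp)).hasMFDerivAt
  have h4 := (hB.hasMFDerivAt.comp p h3).mfderiv
  exact congrArg (fun L => L v) h4

theorem IsMinimalImmersion.motion_comp {f : M → E3} (hf : IsMinimalImmersion f) :
    IsMinimalImmersion (B ∘ f) where
  smooth := by
    have hB : ContDiff ℝ ∞ B := by
      have h : (B : E3 → E3) = fun x => B.linearIsometryEquiv x + B 0 := funext (motion_apply B)
      rw [h]
      exact B.linearIsometryEquiv.contDiff.add contDiff_const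
    exact hB.contMDiff.comp hf.smooth
  injective_differential p x y hxy := by
    rw [differential_motion_comp B hf.smooth, differential_motion_comp B hf.smooth] at hxy
    exact hf.injective_differential p (B.linearIsometryEquiv.injective hxy)
  meanCurvature_eq_zero e he u hu ν hν horth := by
    obtain ⟨μ, rfl⟩ := B.linearIsometryEquiv.surjective ν
    rw [Function.comp_assoc, meanCurvature_motion_comp]
    refine hf.meanCurvature_eq_zero e he u hu μ (by simpa using hν) fun i => ?_
    have := horth i
    rwa [Function.comp_assoc, partialDeriv_motion_comp, Function.comp_apply,
      LinearIsometryEquiv.inner_map_map] at this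

theorem inducedEDist_motion_comp {f : M → E3} (hf : ContMDiff (𝓡 2) 𝓘(ℝ, E3) ∞ f) (p q : M) :
    inducedEDist (B ∘ f) p q = inducedEDist f p q := by
  have h : (fun x : M => (⟨fun v => ‖differential (B ∘ f) x v‖ₑ⟩ : ENorm (TangentSpace (𝓡 2) x))) =
      fun x : M => ⟨fun v => ‖differential f x v‖ₑ⟩ := by
    funext x
    congr 1
    funext v
    rw [differential_motion_comp B hf, ← ofReal_norm, ← ofReal_norm,
      LinearIsometryEquiv.norm_map]
  unfold inducedEDist
  rw [h]

theorem IsCompleteSurface.motion_comp {f : M → E3} (hcomplete : IsCompleteSurface f)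
    (hf : ContMDiff (𝓡 2) 𝓘(ℝ, E3) ∞ f) : IsCompleteSurface (B ∘ f) := by
  intro x hx
  simp only [inducedEDist_motion_comp B hf] at hx
  exact hcomplete x hx

theorem deriv_motion_comp (c : ℝ → E3) : deriv (B ∘ c) = B.linearIsometryEquiv ∘ deriv c :=
  funext fun t => by
    simp only [← fderiv_apply_one_eq_deriv, Function.comp_apply]
    exact fderiv_motion_comp B c t 1

theorem ContainsAsGeodesic.motion_comp {f : M → E3} (hf : ContMDiff (𝓡 2) 𝓘(ℝ, E3) ∞ f)
    {c : ℝ → E3} (h : ContainsAsGeodesic f c) : ContainsAsGeodesic (B ∘ f) (B ∘ c) := by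
  obtain ⟨γ, hγ, hc⟩ := h
  have d1 : deriv ((B ∘ f) ∘ γ) = B.linearIsometryEquiv ∘ deriv (f ∘ γ) :=
    deriv_motion_comp B (f ∘ γ)
  refine ⟨γ, ⟨hγ.smooth, fun t => ?_, fun t => ?_⟩, fun t => congrArg B (hc t)⟩
  · rw [d1, Function.comp_apply]
    simpa using hγ.regular t
  · obtain ⟨a, ha⟩ := hγ.acceleration t
    refine ⟨a, fun v => ?_⟩
    have d2 : deriv (B.linearIsometryEquiv ∘ deriv (f ∘ γ)) t =
        B.linearIsometryEquiv (deriv (deriv (f ∘ γ)) t) := by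
      rw [← fderiv_apply_one_eq_deriv, LinearIsometryEquiv.comp_fderiv]
      rfl
    rw [d1, d2, Function.comp_apply, ← map_smul, ← map_sub, differential_motion_comp B hf,
      LinearIsometryEquiv.inner_map_map]
    exact ha v

end Motion

end MinimalEpitrochoid

end

theorem mainTheorem1
    {M : Type*} [TopologicalSpace M] [T2Space M]
    [ChartedSpace (EuclideanSpace ℝ (Fin 2)) M] [IsManifold (𝓡 2) ∞ M]
    (f : M → EuclideanSpace ℝ (Fin 3))
    (hmin : MinimalEpitrochoid.IsMinimalImmersion f) (hcomplete : MinimalEpitrochoid.IsCompleteSurface f)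
    (rc rm lam : ℝ) (hrc : 0 < rc) (hrm : 0 < rm) (hlam : 0 < lam)
    (hreg : lam ≠ rm) (hsingle : MinimalEpitrochoid.IsSingleWrapped rc rm)
    (motion : EuclideanSpace ℝ (Fin 3) ≃ᵃⁱ[ℝ] EuclideanSpace ℝ (Fin 3)) :
    ¬ MinimalEpitrochoid.ContainsAsGeodesic f
      (fun t => motion (MinimalEpitrochoid.epitrochoid rc rm lam t)) := by
  intro h
  have h1 := h.motion_comp motion.symm hmin.smooth
  refine MinimalEpitrochoid.not_containsAsGeodesic_epitrochoid (hmin.motion_comp motion.symm)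
    (hcomplete.motion_comp motion.symm hmin.smooth) hrc hrm hlam hreg ?_
  convert h1 using 1
  funext t
  exact (motion.symm_apply_apply _).symm
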